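/- Setting. A BMS channel $W$ assigns to each input $x\in\{\pm1\}$ a probability law $W(\cdot\,|\,x)$ on $\mathbb{R}$ with $W(E\,|\,{-1})=W(-E\,|\,1)$; its capacity $C$ (in bits) is the supremum of $I(X;Y)$ over all input distributions. For a binary linear code $\mathcal{C}\subseteq\mathbb{F}_2^N$ let $R(\mathcal{C})=\dim(\mathcal{C})/N$, let $\mathcal{G}(\mathcal{C})$ be the group of coordinate permutations that map $\mathcal{C}$ into itself, and let $\mathcal{G}_0(\mathcal{C})$ be the stabilizer of coordinate $0$ in $\mathcal{G}(\mathcal{C})$; $\mathcal{C}$ is transitive if $\mathcal{G}(\mathcal{C})$ is transitive on the coordinates $\{0,\dots,N-1\}$. Let $\mathbf{X}$ be uniform on the words $((-1)^{u_0},\dots,(-1)^{u_{N-1}})$, $u\in\mathcal{C}$, let $\mathbf{Y}$ be the output of $N$ independent uses of $W$ with input $\mathbf{X}$, and let $Y_{\sim0}=(Y_1,\dots,Y_{N-1})$. Put $$M(\mathcal{C})=\mathbb{E}\big[(X_0-\mathbb{E}[X_0|Y_{\sim0}])^2\big],\qquad P_b(\mathcal{C})=\mathbb{E}\big[\min\{q,1-q\}\big]\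 \text{ with } q=\Pr(X_0=-1\,|\,Y_{\sim0}),$$ the extrinsic minimum mean-squared error and the extrinsic bit error probability (under bit-MAP decoding) of $X_0$. Statement. Let $W$ be a BMS channel with capacity $C$ and let $(\mathcal{C}_k)_{k\ge0}$ be transitive binary linear codes of lengths $N_k\ge1$. Assume that for each $k\ge 0$ the nonzero coordinates of $\mathcal{C}_{k+1}$ are partitioned into sets $A,B,C',D$ (some possibly empty) such that the projection of $\mathcal{C}_{k+1}$ onto the coordinates $\{0\}\cup A\cup B$ and its projection onto the coordinates $\{0\}\cup A\cup C'$, with the coordinates of each projection listed in some order that starts with $0$, are both equal to $\mathcal{C}_k$. Let $\rho_k$ be the maximum, over all nonempty $S\subseteq\{1,\dots,N_k-1\}$, of $\Pr(\Pi(S)\subseteq A)$ (and $0$ if there is no such $S$), where $\Pi$ is uniformly distributed on $\mathcal{G}_0(\mathcal{C}_k)$ and $A$ is regarded as a set of coordinates of $\mathcal{C}_k$ through the first or the second projection; if the two projections place $A$ at different positions of $\mathcal{C}_k$, then $\rho_k$ is the larger of the two values. Assume that $\rho_k\le\rho_0^*$ for all $k\ge0$ and some real number $\rho_0^*<1$;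 in particular, $\rho_0^*=\rho_0$ is allowed if $\rho_k=\rho_0<1$ for all $k\ge 1$. If $R(\mathcal{C}_0)<C$, then $\delta=C-R(\mathcal{C}_0)>0$, $M(\mathcal{C}_0)\le1-\delta$, and for all $k\ge0$ $$2P_b(\mathcal{C}_k)\le M(\mathcal{C}_k)\le\Big(\frac{1+\rho_0^*}{2}\Big)^k\,\frac{1-\delta}{\delta}.$$ -/

import Mathlib

open MeasureTheory
open scoped ENNReal Pointwise

namespace NestedBMS

noncomputable section

/-! ## Binary linear codes -/

/-- A binary linear code of length `N`: a subspace of `𝔽₂^N`. -/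
abbrev Code (N : ℕ) := Submodule (ZMod 2) (Fin N → ZMod 2)

/-- The code rate `dim 𝒞 / N`. -/
def rate {N : ℕ} (𝒞 : Code N) : ℝ := (Module.finrank (ZMod 2) 𝒞 : ℝ) / N

/-- The permutation automorphism group of `𝒞`: all `π` with `π c ∈ 𝒞` for every `c ∈ 𝒞`, where
`(π c) i = c (π⁻¹ i)`. -/
def autGroup {N : ℕ} (𝒞 : Code N) : Subgroup (Equiv.Perm (Fin N)) where
  carrier := {π | ∀ c ∈ 𝒞, (fun i => c (π⁻¹ i)) ∈ 𝒞}
  one_mem' := by intro c hc; simpa using hc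
  mul_mem' := by
    intro π τ hπ hτ c hc
    simpa [mul_inv_rev] using hπ _ (hτ c hc)
  inv_mem' := by
    intro π hπ c hc
    have hinj : Function.Injective
        (fun d : 𝒞 => (⟨fun i => d.1 (π⁻¹ i), hπ d.1 d.2⟩ : 𝒞)) := by
      intro d e h
      apply Subtype.ext
      funext i
      have h2 := congrFun (congrArg Subtype.val h) (π i)
      simpa using h2
    obtain ⟨d, hd⟩ := (Finite.injective_iff_surjective.mp hinj) ⟨c, hc⟩
    have h3 : (fun i => c (π⁻¹⁻¹ i)) = d.1 := by
      funext i
      have h4 := congrFun (congrArg Subtype.val hd) (π i)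
      simpa using h4.symm
    rw [h3]
    exact d.2

/-- A code is transitive if its automorphism group acts transitively on the coordinates. -/
def IsTransitive {N : ℕ} (𝒞 : Code N) : Prop :=
  ∀ i j : Fin N, ∃ π ∈ autGroup 𝒞, π i = j

/-- The automorphisms of `𝒞` that fix the distinguished coordinate `0`. -/
def bitStabilizer {N : ℕ} [NeZero N] (𝒞 : Code N) : Subgroup (Equiv.Perm (Fin N)) :=
  autGroup 𝒞 ⊓ MulAction.stabilizer (Equiv.Perm (Fin N)) (0 : Fin N)

/-- The projection of `𝒞` onto the coordinates listed, in this order, by `u`. -/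
def project {N N' : ℕ} (𝒞 : Code N') (u : Fin N ↪ Fin N') : Code N :=
  𝒞.map (LinearMap.funLeft (ZMod 2) (ZMod 2) u)

/-- `Pr (Π(S) ⊆ A)` for `Π` uniformly distributed on the automorphisms of `𝒞` that fix `0`. -/
def captureProb {N : ℕ} [NeZero N] (𝒞 : Code N) (S A : Finset (Fin N)) : ℝ :=
  (Nat.card {σ : bitStabilizer 𝒞 // ∀ i ∈ S, σ.1 i ∈ A} : ℝ) / Nat.card (bitStabilizer 𝒞)

/-- The maximum of `Pr (Π(S) ⊆ A)` over all nonempty sets `S` of nonzero coordinates. -/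
def maxCaptureProb {N : ℕ} [NeZero N] (𝒞 : Code N) (A : Finset (Fin N)) : ℝ :=
  ⨆ S : {S : Finset (Fin N) // S.Nonempty ∧ 0 ∉ S}, captureProb 𝒞 S.1 A

/-- Two looks at bit `0` of `𝒞` through copies of `𝒞'`: the nonzero coordinates of `𝒞` are
partitioned into `A`, `B`, `C`, `D`, and `𝒞'` is the projection of `𝒞` onto `{0} ∪ A ∪ B` and also
onto `{0} ∪ A ∪ C`. The maps `u` and `v` list the coordinates of the two projections. -/
structure TwoLooks {N' N : ℕ} [NeZero N'] [NeZero N] (𝒞 : Code N') (𝒞' : Code N) where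
  A : Finset (Fin N')
  B : Finset (Fin N')
  C : Finset (Fin N')
  D : Finset (Fin N')
  disjoint_AB : Disjoint A B
  disjoint_AC : Disjoint A C
  disjoint_AD : Disjoint A D
  disjoint_BC : Disjoint B C
  disjoint_BD : Disjoint B D
  disjoint_CD : Disjoint C D
  union_eq : A ∪ B ∪ C ∪ D = Finset.univ.erase 0
  u : Fin N ↪ Fin N'
  v : Fin N ↪ Fin N'
  u_zero : u 0 = 0
  v_zero : v 0 = 0
  range_u : Finset.univ.map u = insert 0 (A ∪ B)
  range_v : Finset.univ.map v = insert 0 (A ∪ C)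
  project_u : project 𝒞 u = 𝒞'
  project_v : project 𝒞 v = 𝒞'

/-- The overlap parameter of two looks: the maximum of `Pr (Π(S) ⊆ A)`, where the shared set `A` is
read as a set of coordinates of `𝒞'` through either look. If the shared coordinates occupy the same
positions in both copies of `𝒞'`, the two readings of `A` are the same set. -/
def TwoLooks.overlap {N' N : ℕ} [NeZero N'] [NeZero N] {𝒞 : Code N'} {𝒞' : Code N}
    (T : TwoLooks 𝒞 𝒞') : ℝ :=
  max (maxCaptureProb 𝒞' (T.A.preimage T.u T.u.injective.injOn))
    (maxCaptureProb 𝒞' (T.A.preimage T.v T.v.injective.injOn))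

/-! ## Binary memoryless symmetric channels -/

/-- A BMS channel: input alphabet `{±1}`, output alphabet `ℝ`, with `law x` the law of the output
given the input `x`, and `law (-1) E = law 1 (-E)`. -/
structure BMSChannel where
  law : ℤˣ → Measure ℝ
  isProb : ∀ x, IsProbabilityMeasure (law x)
  symm : ∀ E : Set ℝ, MeasurableSet E → law (-1) E = law 1 (-E)

instance (W : BMSChannel) (x : ℤˣ) : IsProbabilityMeasure (W.law x) := W.isProb x

/-- A unit `±1` of the integers as a real number. -/
def sgn (x : ℤˣ) : ℝ := ((x : ℤ) : ℝ)

/-- The joint law of input and output for one channel use, when the input is `1` with probability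
`p` and `-1` with probability `1 - p`. -/
def BMSChannel.joint (W : BMSChannel) (p : unitInterval) : Measure (ℝ × ℝ) :=
  ENNReal.ofReal p • (Measure.dirac (sgn 1)).prod (W.law 1) +
    ENNReal.ofReal (1 - p) • (Measure.dirac (sgn (-1))).prod (W.law (-1))

/-- The mutual information (in nats) of a joint law: the Kullback-Leibler divergence from the
product of its marginals. -/
def mutualInfo (P : Measure (ℝ × ℝ)) : ℝ≥0∞ :=
  InformationTheory.klDiv P (P.fst.prod P.snd)

/-- The channel capacity in bits: the supremum of the mutual information between input and output
over all input distributions. -/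
def BMSChannel.capacity (W : BMSChannel) : ℝ :=
  (⨆ p : unitInterval, mutualInfo (W.joint p)).toReal / Real.log 2

/-- The BPSK map `u ↦ (-1)^u`. -/
def bpsk (u : ZMod 2) : ℤˣ := (-1) ^ u.val

/-- The joint law of `(X, Y)`, where `X` is a uniform random codeword of `𝒞` (in BPSK form) and `Y`
is the observation of `X` through `N` independent uses of `W`. -/
def transmitLaw {N : ℕ} (W : BMSChannel) (𝒞 : Code N) :
    Measure ((Fin N → ℝ) × (Fin N → ℝ)) :=
  (Nat.card 𝒞 : ℝ≥0∞)⁻¹ • Measure.sum fun c : 𝒞 =>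
    (Measure.dirac fun i => sgn (bpsk (c.1 i))).prod (Measure.pi fun i => W.law (bpsk (c.1 i)))

/-- The sigma-algebra generated by the extrinsic observation, that is, all `Y i` with `i ≠ 0`. -/
@[reducible]
def extrinsic (N : ℕ) [NeZero N] : MeasurableSpace ((Fin N → ℝ) × (Fin N → ℝ)) :=
  MeasurableSpace.comap (fun ω (i : {i : Fin N // i ≠ 0}) => ω.2 i.1) inferInstance

/-- The extrinsic conditional mean of `X 0`. -/
def condMean {N : ℕ} [NeZero N] (W : BMSChannel) (𝒞 : Code N) :
    (Fin N → ℝ) × (Fin N → ℝ) → ℝ :=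
  (transmitLaw W 𝒞)[fun ω => ω.1 0 | extrinsic N]

/-- The extrinsic minimum mean-squared error of `X 0`. -/
def extMMSE {N : ℕ} [NeZero N] (W : BMSChannel) (𝒞 : Code N) : ℝ :=
  ∫ ω, (ω.1 0 - condMean W 𝒞 ω) ^ 2 ∂(transmitLaw W 𝒞)

/-- The posterior probability of `X 0 = -1` given the extrinsic observation. -/
def posterior {N : ℕ} [NeZero N] (W : BMSChannel) (𝒞 : Code N) :
    (Fin N → ℝ) × (Fin N → ℝ) → ℝ :=
  (transmitLaw W 𝒞)[Set.indicator {ω | ω.1 0 = -1} (fun _ => (1 : ℝ)) | extrinsic N]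

/-- The extrinsic bit error probability under bit-MAP decoding of `X 0`: the decoder errs with
conditional probability `min q (1 - q)`, where `q` is the posterior probability of `X 0 = -1`. -/
def bitErrorProb {N : ℕ} [NeZero N] (W : BMSChannel) (𝒞 : Code N) : ℝ :=
  ∫ ω, min (posterior W 𝒞 ω) (1 - posterior W 𝒞 ω) ∂(transmitLaw W 𝒞)

end

end NestedBMS

/-! Let m = E[X₀ | Y_∼0] and let q = E[m²] (`extEnergy`). Since X₀² = 1 and E[X₀ m] = E[m²], the
mean-squared error is M = 1 - q. The posterior is (1 - m)/2, so 2 P_b = 1 - E|m| ≤ 1 - q because |m|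
≤ 1. It remains to bound q from below along the sequence.

Start (`capacity_sub_rate_le`). Compare the law of the outputs with the i.i.d. law of outputs of
uniform inputs. Revealing the outputs one at a time, coordinate i adds to the divergence at most log
2 times the second moment of the estimate of X_i from the outputs already seen. This follows from
(1+s)log(1+s) + (1-s)log(1-s) ≤ 2 log 2 · s². By monotonicity in the observations and by
transitivity each increment is at most q log 2. The total divergence is at least N·I - log|𝒞|, where
I is the information of a uniform input, and I is at least the capacity in nats. Hence q(𝒞₀) ≥ C - R
= δ.

Recursion (`TwoLooks.two_mul_extEnergy_le`). Let f and g be the estimates of X₀ by the two looks,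
each of energy q. By linearity and channel symmetry the all-ones input may be assumed, so that the
outputs are i.i.d. and E f = E f² = q. Then f and g interact only through A: E[fg] = E[E[f|A]
E[g|A]]. The set function h(T) = E[E[f|T]²] satisfies ⟨E[f|T], E[f|T']⟩ = h(T ∩ T'), a Gram matrix,
so its Möbius weights are nonnegative (they are the energies in the Efron-Stein decomposition). As h
is invariant under the stabilizer of 0, averaging over it gives h(A) = ∑ w(S) Pr(Π(S) ⊆ A) ≤ (1-ρ)
h(∅) + ρ h(univ) = (1-ρ)q² + ρq (`InterPSD.le_of_capture`). Thus E(f+g)² ≤ 2qD with D = 1 + ρ +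
(1-ρ)q, and comparing the optimal estimate for the longer code with (f+g)/D yields a new energy q'
with 2q ≤ q'D.

Since D - 2q = (1+ρ)(1-q), the odds (1-q)/q shrink by the factor (1+ρ)/2 at every step, starting
from at most (1-δ)/δ; finally q ≤ 1. -/

namespace NestedBMS

/-! ### A quadratic bound on the binary entropy deficit -/

lemma hasSum_entropy_deficit {s : ℝ} (hs : |s| < 1) :
    HasSum (fun k : ℕ => s ^ (2 * k + 2) * (1 / ((2 * k + 1) * (k + 1))))
      ((1 + s) * Real.log (1 + s) + (1 - s) * Real.log (1 - s)) := by
  obtain ⟨h1, h2⟩ := abs_lt.1 hs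
  have hsq : |s ^ 2| < 1 := by
    rw [abs_pow]; exact pow_lt_one₀ (abs_nonneg s) hs two_ne_zero
  have a := (Real.hasSum_log_sub_log_of_abs_lt_one hs).mul_left s
  have b := Real.hasSum_pow_div_log_of_abs_lt_one hsq
  have e : Real.log (1 - s ^ 2) = Real.log (1 + s) + Real.log (1 - s) := by
    rw [← Real.log_mul (by linarith) (by linarith)]; congr 1; ring
  have h := a.sub b
  have hf : (fun k : ℕ => s ^ (2 * k + 2) * (1 / ((2 * k + 1) * (k + 1)))) = fun k : ℕ =>
      s * (2 * (1 / (2 * k + 1)) * s ^ (2 * k + 1)) - (s ^ 2) ^ (k + 1) / (k + 1) := by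
    funext k
    have : (2 * (k : ℝ) + 1) ≠ 0 := by positivity
    have : ((k : ℝ) + 1) ≠ 0 := by positivity
    field_simp
    ring
  have hv : (1 + s) * Real.log (1 + s) + (1 - s) * Real.log (1 - s) =
      s * (Real.log (1 + s) - Real.log (1 - s)) - -Real.log (1 - s ^ 2) := by
    rw [e]; ring
  rw [hf, hv]
  exact h

/-- The power series is even, starts at degree two and has nonnegative coefficients, so its quotient
by `s ^ 2` is monotone on [0, 1). The cross-multiplied form also covers `s = 0`. -/
lemma entropy_deficit_mul_sq_le {s r : ℝ} (hs : 0 ≤ s) (hsr : s ≤ r) (hr : r < 1) :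
    ((1 + s) * Real.log (1 + s) + (1 - s) * Real.log (1 - s)) * r ^ 2 ≤
      ((1 + r) * Real.log (1 + r) + (1 - r) * Real.log (1 - r)) * s ^ 2 := by
  have a := (hasSum_entropy_deficit (s := s) (by rw [abs_of_nonneg hs]; linarith)).mul_right (r ^ 2)
  have b := (hasSum_entropy_deficit (s := r) (by rw [abs_of_nonneg (by linarith)]; linarith)).mul_right
    (s ^ 2)
  refine hasSum_le (fun k => ?_) a b
  have h1 : s ^ (2 * k) ≤ r ^ (2 * k) := pow_le_pow_left₀ hs hsr _
  have h2 : 0 ≤ s ^ 2 * r ^ 2 * (1 / ((2 * (k : ℝ) + 1) * (k + 1))) := by positivity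
  calc _ = s ^ (2 * k) * (s ^ 2 * r ^ 2 * (1 / ((2 * (k : ℝ) + 1) * (k + 1)))) := by ring
    _ ≤ r ^ (2 * k) * (s ^ 2 * r ^ 2 * (1 / ((2 * (k : ℝ) + 1) * (k + 1)))) := by gcongr
    _ = _ := by ring

lemma entropy_deficit_le {s : ℝ} (hs : |s| ≤ 1) :
    (1 + s) * Real.log (1 + s) + (1 - s) * Real.log (1 - s) ≤ 2 * Real.log 2 * s ^ 2 := by
  wlog h0 : 0 ≤ s generalizing s with H
  · have := H (s := -s) (by rwa [abs_neg]) (by linarith)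
    simp only [sub_neg_eq_add, ← sub_eq_add_neg, even_two.neg_pow] at this
    linarith
  rw [abs_of_nonneg h0] at hs
  rcases hs.eq_or_lt with rfl | hs1
  · norm_num
  -- The constant `2 * log 2` is the value of the deficit at 1, where the series lemma does not
  -- apply; it is reached as a left limit, by continuity of x log x.
  have hc : Continuous fun r : ℝ =>
      ((1 + r) * Real.log (1 + r) + (1 - r) * Real.log (1 - r)) := by
    have h := Real.continuous_mul_log
    exact (h.comp (continuous_const.add continuous_id)).add
      (h.comp (continuous_const.sub continuous_id))
  have hl : Filter.Tendsto (fun r : ℝ => ((1 + s) * Real.log (1 + s) +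
      (1 - s) * Real.log (1 - s)) * r ^ 2) (nhdsWithin 1 (Set.Iio 1))
      (nhds (((1 + s) * Real.log (1 + s) + (1 - s) * Real.log (1 - s)) * 1 ^ 2)) :=
    ((continuous_const.mul (continuous_pow 2)).tendsto 1).mono_left nhdsWithin_le_nhds
  have hr := ((hc.mul (continuous_const (y := s ^ 2))).tendsto 1).mono_left
    (nhdsWithin_le_nhds (s := Set.Iio 1))
  have hev : ∀ᶠ r in nhdsWithin (1 : ℝ) (Set.Iio 1), s ≤ r ∧ r < 1 := by
    filter_upwards [Ioo_mem_nhdsLT hs1] with r hr using ⟨hr.1.le, hr.2⟩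
  have := le_of_tendsto_of_tendsto hl hr
    (hev.mono fun r hr => entropy_deficit_mul_sq_le h0 hr.1 hr.2)
  norm_num at this
  linarith

/-! ### Möbius weights of set functions -/

section Mobius

variable {α : Type*} [DecidableEq α]

/-- The Möbius transform of a set function. -/
def mobius (h : Finset α → ℝ) (S : Finset α) : ℝ :=
  ∑ T ∈ S.powerset, (-1) ^ (S \ T).card * h T

lemma sum_powerset_mobius (h : Finset α → ℝ) (A : Finset α) :
    ∑ S ∈ A.powerset, mobius h S = h A := by
  have : ∀ S ∈ A.powerset, mobius h S =
      ∑ T ∈ A.powerset, if T ⊆ S then (-1) ^ (S \ T).card * h T else 0 := by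
    intro S hS
    rw [← Finset.sum_filter]
    refine Finset.sum_congr ?_ fun _ _ => rfl
    ext T
    simp only [Finset.mem_powerset, Finset.mem_filter] at hS ⊢
    exact ⟨fun hT => ⟨hT.trans hS, hT⟩, fun hT => hT.2⟩
  rw [Finset.sum_congr rfl this, Finset.sum_comm]
  have : ∀ T ∈ A.powerset, (∑ S ∈ A.powerset, if T ⊆ S then (-1) ^ (S \ T).card * h T else 0) =
      if T = A then h A else 0 := by
    intro T hT
    rw [Finset.mem_powerset] at hT
    rw [← Finset.sum_filter, ← Finset.sum_mul]
    have : ∑ S ∈ A.powerset with T ⊆ S, (-1 : ℝ) ^ (S \ T).card =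
        ∑ R ∈ (A \ T).powerset, (-1 : ℝ) ^ R.card := by
      -- Sets between `T` and `A` correspond to subsets of `A \ T`, whose alternating sum vanishes
      -- unless `A \ T` is empty.
      refine Finset.sum_nbij' (fun S => S \ T) (fun R => R ∪ T) ?_ ?_ ?_ ?_ ?_
      · intro S hS
        simp only [Finset.mem_powerset, Finset.mem_filter] at hS ⊢
        exact Finset.sdiff_subset_sdiff hS.1 le_rfl
      · intro R hR
        simp only [Finset.mem_powerset, Finset.mem_filter] at hR ⊢
        exact ⟨Finset.union_subset (hR.trans Finset.sdiff_subset) hT, Finset.subset_union_right⟩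
      · intro S hS
        simp only [Finset.mem_filter] at hS
        exact Finset.sdiff_union_of_subset hS.2
      · intro R hR
        simp only [Finset.mem_powerset] at hR
        exact Finset.union_sdiff_cancel_right (Finset.disjoint_sdiff.symm.mono_left hR)
      · intros; rfl
    rw [this]
    have key := Finset.sum_powerset_neg_one_pow_card (x := A \ T)
    have key' : ∑ R ∈ (A \ T).powerset, (-1 : ℝ) ^ R.card = if A \ T = ∅ then 1 else 0 := by
      exact_mod_cast congrArg (Int.cast : ℤ → ℝ) key
    rw [key']
    by_cases hTA : T = A
    · subst hTA; simp
    · rw [if_neg, if_neg hTA, zero_mul]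
      exact fun h0 => hTA (hT.antisymm (Finset.sdiff_eq_empty_iff_subset.1 h0))
  rw [Finset.sum_congr rfl this, Finset.sum_ite_eq' , if_pos (Finset.mem_powerset_self A)]

/-- For `x ∈ S \ T`, the sets `T'` and `insert x T'` meet `T` in the same set but carry opposite
signs, so the terms cancel in pairs. -/
lemma sum_alternating_inter {S T : Finset α} (hT : T ⊆ S) (hne : T ≠ S) (h : Finset α → ℝ) :
    ∑ T' ∈ S.powerset, (-1) ^ (S \ T').card * h (T ∩ T') = 0 := by
  obtain ⟨x, hxS, hxT⟩ := Finset.exists_of_ssubset (hT.ssubset_of_ne hne)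
  obtain ⟨R, hxR, rfl⟩ : ∃ R, x ∉ R ∧ insert x R = S :=
    ⟨S.erase x, Finset.notMem_erase _ _, Finset.insert_erase hxS⟩
  rw [Finset.sum_powerset_insert hxR, ← Finset.sum_add_distrib]
  refine Finset.sum_eq_zero fun T' hT' => ?_
  rw [Finset.mem_powerset] at hT'
  have hx : x ∉ T' := fun h => hxR (hT' h)
  have h1 : insert x R \ insert x T' = R \ T' := by
    ext a; simp only [Finset.mem_sdiff, Finset.mem_insert]; grind
  rw [h1, Finset.insert_sdiff_of_notMem _ hx, Finset.card_insert_of_notMem (by grind),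
    Finset.inter_insert_of_notMem hxT]
  ring

/-- Positive definiteness of `(T, T') ↦ h (T ∩ T')`. -/
def InterPSD (h : Finset α → ℝ) : Prop :=
  ∀ (s : Finset (Finset α)) (a : Finset α → ℝ), 0 ≤ ∑ T ∈ s, ∑ T' ∈ s, a T * a T' * h (T ∩ T')

/-- Test positivity on the signs `(-1) ^ |S \ T|`, `T ⊆ S`: every row `T ≠ S` of the quadratic form
cancels, and the row `T = S` is the Möbius weight itself. -/
lemma InterPSD.mobius_nonneg {h : Finset α → ℝ} (hh : InterPSD h) (S : Finset α) :
    0 ≤ mobius h S := by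
  have key := hh S.powerset fun T => (-1) ^ (S \ T).card
  have h1 : ∀ T ∈ S.powerset, ∑ T' ∈ S.powerset,
      ((-1) ^ (S \ T).card * (-1) ^ (S \ T').card * h (T ∩ T') : ℝ) =
      if T = S then mobius h S else 0 := by
    intro T hT
    rw [Finset.mem_powerset] at hT
    simp_rw [mul_assoc]
    rw [← Finset.mul_sum]
    split_ifs with hTS
    · subst hTS
      rw [Finset.sdiff_self, Finset.card_empty, pow_zero, one_mul, mobius]
      refine Finset.sum_congr rfl fun T' hT' => ?_
      rw [Finset.inter_eq_right.2 (Finset.mem_powerset.1 hT')]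
    · rw [sum_alternating_inter hT hTS, mul_zero]
  rwa [Finset.sum_congr rfl h1, Finset.sum_ite_eq', if_pos (Finset.mem_powerset_self S)] at key

/-- Expand `h A` in Möbius weights and average over `G`. The weight of a nonempty `S` is then
multiplied by the probability that a random group element maps `S` into `A`; since weights are
nonnegative, this factor may be replaced by `ρ`. -/
lemma InterPSD.le_of_capture [Fintype α] {h : Finset α → ℝ} (hh : InterPSD h)
    (G : Subgroup (Equiv.Perm α)) (hinv : ∀ σ ∈ G, ∀ S, h (S.map σ.toEmbedding) = h S)
    (A : Finset α) {ρ : ℝ}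
    (hρ : ∀ S : Finset α, S.Nonempty →
      (Nat.card {σ : G // ∀ i ∈ S, σ.1 i ∈ A} : ℝ) / Nat.card G ≤ ρ) :
    h A ≤ (1 - ρ) * h ∅ + ρ * h Finset.univ := by
  classical
  have : Fintype G := Fintype.ofFinite G
  have hG : (0 : ℝ) < Nat.card G := by exact_mod_cast Nat.card_pos
  have hemp : mobius h ∅ = h ∅ := by simp [mobius]
  -- By invariance `h A = h (σ⁻¹ A)`, and `S ⊆ σ⁻¹ A` means that `σ` maps `S` into `A`.
  have e1 : ∀ σ : G, h A = ∑ S : Finset α,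
      if ∀ i ∈ S, σ.1 i ∈ A then mobius h S else 0 := by
    intro σ
    have e2 : h A = h (A.map (σ⁻¹ : G).1.toEmbedding) := (hinv _ (σ⁻¹).2 A).symm
    rw [e2, ← sum_powerset_mobius h, ← Finset.sum_filter]
    refine Finset.sum_congr ?_ fun _ _ => rfl
    ext S
    simp only [Finset.mem_powerset, Finset.mem_filter, Finset.mem_univ, true_and,
      Finset.subset_iff, Finset.mem_map_equiv]
    exact forall₂_congr fun i _ => by simp [Equiv.Perm.inv_def]
  have e3 : Nat.card G * h A = ∑ S : Finset α,
      (Nat.card {σ : G // ∀ i ∈ S, σ.1 i ∈ A} : ℝ) * mobius h S := by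
    calc (Nat.card G : ℝ) * h A = ∑ σ : G, h A := by
          rw [Finset.sum_const, Finset.card_univ, Nat.card_eq_fintype_card, nsmul_eq_mul]
      _ = ∑ σ : G, ∑ S : Finset α, if ∀ i ∈ S, σ.1 i ∈ A then mobius h S else 0 :=
          Finset.sum_congr rfl fun σ _ => e1 σ
      _ = _ := by
          rw [Finset.sum_comm]
          refine Finset.sum_congr rfl fun S _ => ?_
          rw [← Finset.sum_filter, Finset.sum_const, nsmul_eq_mul, Nat.card_eq_fintype_card,
            Fintype.card_subtype]
  have e4 : ∑ S : Finset α, mobius h S = h Finset.univ := by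
    rw [← sum_powerset_mobius h Finset.univ, Finset.powerset_univ]
  have e5 : Nat.card G * h A ≤ Nat.card G * ((1 - ρ) * h ∅ + ρ * h Finset.univ) := by
    rw [e3, ← e4, ← Finset.add_sum_erase _ _ (Finset.mem_univ ∅),
      ← Finset.add_sum_erase _ (mobius h) (Finset.mem_univ ∅), hemp]
    have hcard : (Nat.card {σ : G // ∀ i ∈ (∅ : Finset α), σ.1 i ∈ A} : ℝ) = Nat.card G := by
      simp
    have hle : ∑ S ∈ Finset.univ.erase ∅,
        (Nat.card {σ : G // ∀ i ∈ S, σ.1 i ∈ A} : ℝ) * mobius h S ≤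
        ∑ S ∈ Finset.univ.erase ∅, (Nat.card G * ρ) * mobius h S := by
      refine Finset.sum_le_sum fun S hS => ?_
      refine mul_le_mul_of_nonneg_right ?_ (hh.mobius_nonneg S)
      rw [mul_comm, ← div_le_iff₀ hG]
      exact hρ S (Finset.nonempty_of_ne_empty (Finset.ne_of_mem_erase hS))
    rw [hcard]
    rw [← Finset.mul_sum] at hle
    calc _ ≤ _ := add_le_add_right hle _
      _ = _ := by ring
  exact le_of_mul_le_mul_left e5 hG

end Mobius

/-! ### Bounded measurable functions -/

/-- A bounded measurable real function. -/
structure BddMeas {Ω : Type*} [MeasurableSpace Ω] (f : Ω → ℝ) : Prop where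
  meas : Measurable f
  bdd : ∃ C, ∀ x, |f x| ≤ C

namespace BddMeas

variable {Ω Ω' : Type*} [MeasurableSpace Ω] [MeasurableSpace Ω'] {f g : Ω → ℝ}

lemma const (c : ℝ) : BddMeas fun _ : Ω => c := ⟨measurable_const, |c|, fun _ => le_rfl⟩

lemma add (hf : BddMeas f) (hg : BddMeas g) : BddMeas fun x => f x + g x := by
  obtain ⟨C, hC⟩ := hf.bdd
  obtain ⟨D, hD⟩ := hg.bdd
  exact ⟨hf.meas.add hg.meas, C + D, fun x => (abs_add_le _ _).trans (add_le_add (hC x) (hD x))⟩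

lemma mul (hf : BddMeas f) (hg : BddMeas g) : BddMeas fun x => f x * g x := by
  obtain ⟨C, hC⟩ := hf.bdd
  obtain ⟨D, hD⟩ := hg.bdd
  refine ⟨hf.meas.mul hg.meas, C * D, fun x => ?_⟩
  rw [abs_mul]
  exact mul_le_mul (hC x) (hD x) (abs_nonneg _) ((abs_nonneg _).trans (hC x))

lemma const_mul (hf : BddMeas f) (c : ℝ) : BddMeas fun x => c * f x := (const c).mul hf

lemma neg (hf : BddMeas f) : BddMeas fun x => -f x := by
  simpa using hf.const_mul (-1)

lemma sub (hf : BddMeas f) (hg : BddMeas g) : BddMeas fun x => f x - g x := by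
  simpa [sub_eq_add_neg] using hf.add hg.neg

lemma pow (hf : BddMeas f) (n : ℕ) : BddMeas fun x => f x ^ n := by
  obtain ⟨C, hC⟩ := hf.bdd
  exact ⟨hf.meas.pow_const n, C ^ n, fun x => by
    rw [abs_pow]; exact pow_le_pow_left₀ (abs_nonneg _) (hC x) n⟩

lemma sum {κ : Type*} {s : Finset κ} {F : κ → Ω → ℝ} (h : ∀ k ∈ s, BddMeas (F k)) :
    BddMeas fun x => ∑ k ∈ s, F k x := by
  classical
  induction s using Finset.induction_on with
  | empty => simpa using const 0
  | insert a s ha ih =>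
    simp_rw [Finset.sum_insert ha]
    exact (h a (Finset.mem_insert_self _ _)).add (ih fun k hk => h k (Finset.mem_insert_of_mem hk))

lemma prod {κ : Type*} {s : Finset κ} {F : κ → Ω → ℝ} (h : ∀ k ∈ s, BddMeas (F k)) :
    BddMeas fun x => ∏ k ∈ s, F k x := by
  classical
  induction s using Finset.induction_on with
  | empty => simpa using const 1
  | insert a s ha ih =>
    simp_rw [Finset.prod_insert ha]
    exact (h a (Finset.mem_insert_self _ _)).mul (ih fun k hk => h k (Finset.mem_insert_of_mem hk))

lemma comp (hf : BddMeas f) {φ : Ω' → Ω} (hφ : Measurable φ) : BddMeas fun x => f (φ x) := by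
  obtain ⟨C, hC⟩ := hf.bdd
  exact ⟨hf.meas.comp hφ, C, fun x => hC _⟩

lemma continuous_comp {φ : ℝ → ℝ} (hφ : Continuous φ) (hf : BddMeas f) :
    BddMeas fun x => φ (f x) := by
  obtain ⟨C, hC⟩ := hf.bdd
  obtain ⟨D, hD⟩ := (isCompact_Icc (a := -C) (b := C)).exists_bound_of_continuousOn
    hφ.continuousOn
  exact ⟨hφ.measurable.comp hf.meas, D, fun x => hD _ (abs_le.1 (hC x))⟩

lemma integrable (hf : BddMeas f) (μ : Measure Ω) [IsFiniteMeasure μ] : Integrable f μ := by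
  obtain ⟨C, hC⟩ := hf.bdd
  exact Integrable.of_bound hf.meas.aestronglyMeasurable C (Filter.Eventually.of_forall hC)

lemma integral_comp (hf : BddMeas f) {φ : Ω' → Ω} {μ' : Measure Ω'} {μ : Measure Ω}
    (h : MeasurePreserving φ μ' μ) : ∫ x, f (φ x) ∂μ' = ∫ x, f x ∂μ := by
  rw [← h.map_eq, integral_map h.measurable.aemeasurable hf.meas.aestronglyMeasurable]

end BddMeas

/-! ### Averaging out coordinates of a product measure -/

section Averaging

variable {ι : Type*} [Fintype ι] [DecidableEq ι] (ν : Measure ℝ) [IsProbabilityMeasure ν]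

/-- Exchanging the coordinates outside `T` between two independent copies preserves their joint law.
This exchangeability is what makes `condAvg` self-adjoint. -/
lemma measurePreserving_piecewise_swap (T : Finset ι) :
    MeasurePreserving (fun p : (ι → ℝ) × (ι → ℝ) => (T.piecewise p.1 p.2, T.piecewise p.2 p.1))
      ((Measure.pi fun _ => ν).prod (Measure.pi fun _ => ν))
      ((Measure.pi fun _ => ν).prod (Measure.pi fun _ => ν)) := by
  have e := measurePreserving_arrowProdEquivProdArrow ℝ ℝ ι (fun _ => ν) (fun _ => ν)
  have hs : ∀ i : ι, MeasurePreserving (if i ∈ T then id else Prod.swap : ℝ × ℝ → ℝ × ℝ)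
      (ν.prod ν) (ν.prod ν) := by
    intro i
    split_ifs
    · exact MeasurePreserving.id _
    · exact Measure.measurePreserving_swap
  have g := measurePreserving_pi (fun _ : ι => ν.prod ν) (fun _ : ι => ν.prod ν) hs
  have := (e.comp g).comp e.symm
  convert this using 1
  funext p
  ext i
  · by_cases hi : i ∈ T <;>
      simp [hi, MeasurableEquiv.arrowProdEquivProdArrow, Equiv.arrowProdEquivProdArrow]
  · by_cases hi : i ∈ T <;>
      simp [hi, MeasurableEquiv.arrowProdEquivProdArrow, Equiv.arrowProdEquivProdArrow]

lemma measurePreserving_piecewise (T : Finset ι) :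
    MeasurePreserving (fun p : (ι → ℝ) × (ι → ℝ) => T.piecewise p.1 p.2)
      ((Measure.pi fun _ => ν).prod (Measure.pi fun _ => ν)) (Measure.pi fun _ => ν) :=
  measurePreserving_fst.comp (measurePreserving_piecewise_swap ν T)

lemma measurePreserving_comp_embedding {κ : Type*} [Fintype κ] (u : κ ↪ ι) :
    MeasurePreserving (fun (y : ι → ℝ) k => y (u k))
      (Measure.pi fun _ => ν) (Measure.pi fun _ => ν) := by
  refine ⟨by fun_prop, (Measure.pi_eq fun s hs => ?_).symm⟩
  rw [Measure.map_apply (by fun_prop) (MeasurableSet.univ_pi hs)]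
  -- The preimage of a box is the box with full sides off the range of `u`, and those sides
  -- contribute factors 1.
  have : (fun (y : ι → ℝ) k => y (u k)) ⁻¹' Set.univ.pi s =
      Set.univ.pi (Function.extend u s fun _ => Set.univ) := by
    ext y
    simp only [Set.mem_preimage, Set.mem_pi, Set.mem_univ, true_implies]
    constructor
    · intro h i
      by_cases hi : ∃ k, u k = i
      · obtain ⟨k, rfl⟩ := hi
        rw [u.injective.extend_apply]
        exact h k
      · rw [Function.extend_apply' _ _ _ hi]
        trivial
    · intro h k
      have := h (u k)
      rwa [u.injective.extend_apply] at this
  rw [this, Measure.pi_pi]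
  refine (Fintype.prod_of_injective u u.injective _ _ (fun i hi => ?_) fun k => ?_).symm
  · rw [Function.extend_apply' _ _ _ hi, measure_univ]
  · rw [u.injective.extend_apply]

/-- The conditional expectation of `F` given the coordinates in `T`, under the product measure. -/
noncomputable def condAvg (T : Finset ι) (F : (ι → ℝ) → ℝ) (y : ι → ℝ) : ℝ :=
  ∫ z, F (T.piecewise y z) ∂(Measure.pi fun _ => ν)

variable {ν} {F G : (ι → ℝ) → ℝ}

lemma measurable_piecewise (T : Finset ι) :
    Measurable fun p : (ι → ℝ) × (ι → ℝ) => T.piecewise p.1 p.2 :=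
  (measurePreserving_piecewise (Measure.dirac 0) T).measurable

lemma BddMeas.condAvg (hF : BddMeas F) (T : Finset ι) : BddMeas (condAvg ν T F) := by
  obtain ⟨C, hC⟩ := hF.bdd
  refine ⟨?_, C, fun y => ?_⟩
  · have h : StronglyMeasurable fun p : (ι → ℝ) × (ι → ℝ) => F (T.piecewise p.1 p.2) :=
      (hF.meas.comp (measurable_piecewise T)).stronglyMeasurable
    exact h.integral_prod_right.measurable
  · have := norm_integral_le_of_norm_le_const (μ := Measure.pi fun _ : ι => ν)
      (f := fun z => F (T.piecewise y z)) (Filter.Eventually.of_forall fun z => hC _)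
    simpa [NestedBMS.condAvg] using this

/-- Under a product measure, conditioning on `T'` and then on `T` keeps only the common coordinates:
a coordinate outside `T ∩ T'` is resampled by one of the two averages. -/
lemma condAvg_condAvg (hF : BddMeas F) (T T' : Finset ι) :
    condAvg ν T (condAvg ν T' F) = condAvg ν (T ∩ T') F := by
  funext y
  unfold NestedBMS.condAvg
  have h : ∀ z w : ι → ℝ, T'.piecewise (T.piecewise y z) w =
      (T ∩ T').piecewise y (T'.piecewise z w) := by
    intro z w
    funext i
    by_cases h1 : i ∈ T <;> by_cases h2 : i ∈ T' <;> simp [h1, h2]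
  simp_rw [h]
  have hm : BddMeas fun z => F ((T ∩ T').piecewise y z) :=
    hF.comp ((measurable_piecewise (T ∩ T')).comp measurable_prodMk_left)
  rw [← hm.integral_comp (measurePreserving_piecewise ν T')]
  exact (integral_prod _ ((hm.comp (measurable_piecewise T')).integrable _)).symm

lemma integral_condAvg_mul (hF : BddMeas F) (hG : BddMeas G) (T : Finset ι) :
    ∫ y, condAvg ν T F y * G y ∂(Measure.pi fun _ => ν) =
      ∫ y, F y * condAvg ν T G y ∂(Measure.pi fun _ => ν) := by
  have hp := measurable_piecewise T
  unfold NestedBMS.condAvg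
  simp_rw [← integral_const_mul, ← integral_mul_const]
  have h1 : BddMeas fun p : (ι → ℝ) × (ι → ℝ) => F p.1 * G (T.piecewise p.1 p.2) :=
    (hF.comp measurable_fst).mul (hG.comp hp)
  have h2 : BddMeas fun p : (ι → ℝ) × (ι → ℝ) => F (T.piecewise p.1 p.2) * G p.1 :=
    (hF.comp hp).mul (hG.comp measurable_fst)
  rw [← integral_prod _ (h1.integrable _), ← integral_prod _ (h2.integrable _),
    ← h1.integral_comp (measurePreserving_piecewise_swap ν T)]
  refine integral_congr_ae (Filter.Eventually.of_forall fun p => ?_)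
  have : T.piecewise (T.piecewise p.1 p.2) (T.piecewise p.2 p.1) = p.1 := by
    funext i
    by_cases h1 : i ∈ T <;> simp [h1]
  simp only [this]

/-- The second moment of the conditional expectation of `F` given the coordinates in `T`. -/
noncomputable def condEnergy (ν : Measure ℝ) (F : (ι → ℝ) → ℝ) (T : Finset ι) : ℝ :=
  ∫ y, condAvg ν T F y ^ 2 ∂(Measure.pi fun _ => ν)

/-- The averages are commuting self-adjoint projections, so both sides are the inner product of `F`
with its projection on `T ∩ T'`. The energies thus form a Gram matrix indexed by sets. -/
lemma integral_condAvg_mul_condAvg (hF : BddMeas F) (T T' : Finset ι) :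
    ∫ y, condAvg ν T F y * condAvg ν T' F y ∂(Measure.pi fun _ => ν) =
      condEnergy ν F (T ∩ T') := by
  unfold condEnergy
  simp_rw [sq]
  rw [integral_condAvg_mul hF (hF.condAvg _), integral_condAvg_mul hF (hF.condAvg _),
    condAvg_condAvg hF, condAvg_condAvg hF, Finset.inter_self]

lemma interPSD_condEnergy (hF : BddMeas F) : InterPSD (condEnergy ν F) := by
  intro s a
  have h : ∀ T T', a T * a T' * condEnergy ν F (T ∩ T') =
      ∫ y, (a T * condAvg ν T F y) * (a T' * condAvg ν T' F y) ∂(Measure.pi fun _ => ν) := by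
    intro T T'
    rw [← integral_condAvg_mul_condAvg hF, ← integral_const_mul]
    refine integral_congr_ae (Filter.Eventually.of_forall fun y => ?_)
    ring
  have hb : ∀ T, BddMeas fun y => a T * condAvg ν T F y := fun T => (hF.condAvg T).const_mul _
  simp_rw [h]
  rw [Finset.sum_congr rfl fun T _ => (integral_finsetSum s fun T' _ =>
      ((hb T).mul (hb T')).integrable _).symm,
    ← integral_finsetSum s fun T _ => (BddMeas.sum fun T' _ => (hb T).mul (hb T')).integrable _]
  refine integral_nonneg fun y => ?_
  simp_rw [← Finset.mul_sum, ← Finset.sum_mul]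
  exact mul_self_nonneg _

lemma condAvg_comp_embedding {κ : Type*} [Fintype κ] [DecidableEq κ] (u : κ ↪ ι)
    {F : (κ → ℝ) → ℝ} (hF : BddMeas F) (T : Finset ι) (y : ι → ℝ) :
    condAvg ν T (fun y => F fun k => y (u k)) y =
      condAvg ν (T.preimage u u.injective.injOn) F fun k => y (u k) := by
  unfold condAvg
  have hm : BddMeas fun z => F ((T.preimage u u.injective.injOn).piecewise (fun k => y (u k)) z) :=
    hF.comp ((measurable_piecewise _).comp measurable_prodMk_left)
  rw [← hm.integral_comp (measurePreserving_comp_embedding ν u)]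
  refine integral_congr_ae (Filter.Eventually.of_forall fun z => ?_)
  refine congrArg F (funext fun k => ?_)
  by_cases h : u k ∈ T <;> simp [h]

lemma condEnergy_comp_embedding {κ : Type*} [Fintype κ] [DecidableEq κ] (u : κ ↪ ι)
    {F : (κ → ℝ) → ℝ} (hF : BddMeas F) (T : Finset ι) :
    condEnergy ν (fun y => F fun k => y (u k)) T =
      condEnergy ν F (T.preimage u u.injective.injOn) := by
  unfold condEnergy
  simp_rw [condAvg_comp_embedding u hF]
  exact ((hF.condAvg _).pow 2).integral_comp (measurePreserving_comp_embedding ν u)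

lemma condEnergy_empty : condEnergy ν F ∅ = (∫ y, F y ∂(Measure.pi fun _ => ν)) ^ 2 := by
  simp [condEnergy, condAvg]

lemma condAvg_eq_self {T : Finset ι} (h : ∀ y z, (∀ i ∈ T, y i = z i) → F y = F z) :
    condAvg ν T F = F := by
  funext y
  have : ∀ z, F (T.piecewise y z) = F y := fun z => h _ _ fun i hi => by simp [hi]
  simp [condAvg, this]

lemma condEnergy_univ :
    condEnergy ν F Finset.univ = ∫ y, F y ^ 2 ∂(Measure.pi fun _ => ν) := by
  rw [condEnergy, condAvg_eq_self]
  intro y z h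
  rw [funext fun i => h i (Finset.mem_univ i)]

/-- Two functions that share only the coordinates in `T ∩ T'` correlate through them. -/
lemma two_mul_integral_mul_le (hF : BddMeas F) (hG : BddMeas G) {T T' : Finset ι}
    (hFT : ∀ y z, (∀ i ∈ T, y i = z i) → F y = F z)
    (hGT : ∀ y z, (∀ i ∈ T', y i = z i) → G y = G z) :
    2 * ∫ y, F y * G y ∂(Measure.pi fun _ => ν) ≤
      condEnergy ν F (T ∩ T') + condEnergy ν G (T ∩ T') := by
  -- Moving the projection on `T` to the other factor replaces `G` by its average over `T ∩ T'`;
  -- idempotence then lets `F` be averaged as well. The rest is 2ab ≤ a² + b².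
  have e : ∫ y, F y * G y ∂(Measure.pi fun _ => ν) =
      ∫ y, condAvg ν (T ∩ T') F y * condAvg ν (T ∩ T') G y ∂(Measure.pi fun _ => ν) := by
    have h1 : ∫ y, F y * G y ∂(Measure.pi fun _ => ν) =
        ∫ y, condAvg ν T F y * condAvg ν T' G y ∂(Measure.pi fun _ => ν) := by
      rw [condAvg_eq_self hFT, condAvg_eq_self hGT]
    rw [h1, integral_condAvg_mul hF (hG.condAvg _), integral_condAvg_mul hF (hG.condAvg _),
      condAvg_condAvg hG, condAvg_condAvg hG, Finset.inter_self]
  rw [e, condEnergy, condEnergy, ← integral_const_mul,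
    ← integral_add (((hF.condAvg _).pow 2).integrable _) (((hG.condAvg _).pow 2).integrable _)]
  refine integral_mono ((((hF.condAvg _).mul (hG.condAvg _)).const_mul 2).integrable _)
    ((((hF.condAvg _).pow 2).add ((hG.condAvg _).pow 2)).integrable _) fun y => ?_
  nlinarith [sq_nonneg (condAvg ν (T ∩ T') F y - condAvg ν (T ∩ T') G y)]

end Averaging

/-! ### Signs as real numbers -/

@[simp] lemma sgn_one : sgn 1 = 1 := by simp [sgn]

@[simp] lemma sgn_neg (x : ℤˣ) : sgn (-x) = -sgn x := by simp [sgn]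

lemma sgn_mul (x y : ℤˣ) : sgn (x * y) = sgn x * sgn y := by simp [sgn]

lemma sgn_eq_or (x : ℤˣ) : sgn x = 1 ∨ sgn x = -1 := by
  rcases Int.units_eq_one_or x with rfl | rfl <;> simp

/-! ### The reference measure and the soft bit of a channel -/

namespace BMSChannel

variable (W : BMSChannel)

/-- The output law for a uniform input. -/
noncomputable def ref : Measure ℝ := (2⁻¹ : ℝ≥0∞) • (W.law 1 + W.law (-1))

instance : IsProbabilityMeasure W.ref := by
  refine ⟨?_⟩
  simp only [ref, Measure.smul_apply, Measure.add_apply, measure_univ, smul_eq_mul]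
  rw [one_add_one_eq_two, ENNReal.inv_mul_cancel two_ne_zero ENNReal.ofNat_ne_top]

lemma law_neg_one : W.law (-1) = (W.law 1).map Neg.neg := by
  ext E hE
  rw [W.symm E hE, Measure.map_apply measurable_neg hE]
  rfl

lemma map_neg_law_neg_one : (W.law (-1)).map Neg.neg = W.law 1 := by
  rw [law_neg_one, Measure.map_map measurable_neg measurable_neg]
  simp

lemma measurePreserving_neg : MeasurePreserving (Neg.neg : ℝ → ℝ) W.ref W.ref := by
  refine ⟨measurable_neg, ?_⟩
  rw [ref, Measure.map_smul, Measure.map_add _ _ measurable_neg, map_neg_law_neg_one,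
    ← law_neg_one, add_comm]

lemma law_one_ac : W.law 1 ≪ W.ref := by
  have h : W.law 1 ≪ W.law 1 + W.law (-1) := (Measure.le_add_right le_rfl).absolutelyContinuous
  exact h.trans (Measure.absolutelyContinuous_smul (by simp))

/-- Half the difference of the output densities of the two inputs: the mean of a uniform input given
the output. -/
noncomputable def softBit (y : ℝ) : ℝ :=
  max (-1) (min 1 ((((W.law 1).rnDeriv W.ref y).toReal - ((W.law 1).rnDeriv W.ref (-y)).toReal) / 2))

/-- Truncation to [-1, 1] is odd, so oddness and boundedness both hold at every point, not merely
almost everywhere. -/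
lemma softBit_neg (y : ℝ) : W.softBit (-y) = -W.softBit y := by
  simp only [softBit, neg_neg]
  generalize ((W.law 1).rnDeriv W.ref y).toReal = a
  generalize ((W.law 1).rnDeriv W.ref (-y)).toReal = b
  have : (b - a) / 2 = -((a - b) / 2) := by ring
  rw [this]
  generalize (a - b) / 2 = c
  grind

lemma abs_softBit_le (y : ℝ) : |W.softBit y| ≤ 1 := by
  rw [abs_le, softBit]
  exact ⟨le_max_left _ _, max_le (by norm_num) (min_le_left _ _)⟩

lemma measurable_softBit : Measurable W.softBit := by
  have h := ((W.law 1).measurable_rnDeriv W.ref)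
  unfold softBit
  fun_prop

lemma bddMeas_softBit : BddMeas W.softBit := ⟨W.measurable_softBit, 1, W.abs_softBit_le⟩

lemma withDensity_neg {d : ℝ → ℝ≥0∞} (hd : Measurable d) :
    (W.ref.withDensity d).map Neg.neg = W.ref.withDensity fun y => d (-y) := by
  ext E hE
  rw [Measure.map_apply measurable_neg hE, withDensity_apply _ hE,
    withDensity_apply _ (measurable_neg hE)]
  have h := W.measurePreserving_neg.setLIntegral_comp_preimage hE (f := fun y => d (-y))
    (by fun_prop)
  simpa using h

/-- By symmetry the density of `W.law (-1)` is the reflected density of `W.law 1`, and the two laws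
sum to twice the reference measure. -/
lemma rnDeriv_add_neg :
    ∀ᵐ y ∂W.ref, (W.law 1).rnDeriv W.ref y + (W.law 1).rnDeriv W.ref (-y) = 2 := by
  have hm := (W.law 1).measurable_rnDeriv W.ref
  have h1 := Measure.withDensity_rnDeriv_eq _ _ W.law_one_ac
  have h2 : W.law (-1) = W.ref.withDensity fun y => (W.law 1).rnDeriv W.ref (-y) := by
    rw [← W.withDensity_neg hm, h1, law_neg_one]
  have h3 : W.ref.withDensity (fun y => (W.law 1).rnDeriv W.ref y + (W.law 1).rnDeriv W.ref (-y)) =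
      W.ref.withDensity fun _ => 2 := by
    have : (fun y => (W.law 1).rnDeriv W.ref y + (W.law 1).rnDeriv W.ref (-y)) =
      (W.law 1).rnDeriv W.ref + fun y => (W.law 1).rnDeriv W.ref (-y) := rfl
    rw [this, withDensity_add_left hm, h1, ← h2, withDensity_const, ref, smul_smul,
      ENNReal.mul_inv_cancel two_ne_zero ENNReal.ofNat_ne_top, one_smul]
  exact (withDensity_eq_iff_of_sigmaFinite (by fun_prop) (by fun_prop)).1 h3

lemma law_one_eq : W.law 1 = W.ref.withDensity fun y => ENNReal.ofReal (1 + W.softBit y) := by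
  rw [← Measure.withDensity_rnDeriv_eq _ _ W.law_one_ac]
  refine withDensity_congr_ae ?_
  filter_upwards [W.rnDeriv_add_neg] with y hy
  have ha : (W.law 1).rnDeriv W.ref y ≠ ∞ := by
    intro h; rw [h] at hy; simp at hy
  have hb : (W.law 1).rnDeriv W.ref (-y) ≠ ∞ := by
    intro h; rw [h] at hy; simp at hy
  have hs : ((W.law 1).rnDeriv W.ref y).toReal + ((W.law 1).rnDeriv W.ref (-y)).toReal = 2 := by
    rw [← ENNReal.toReal_add ha hb, hy]; simp
  have h1 := ENNReal.toReal_nonneg (a := (W.law 1).rnDeriv W.ref y)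
  have h2 := ENNReal.toReal_nonneg (a := (W.law 1).rnDeriv W.ref (-y))
  -- The densities are nonnegative with sum 2, so half their difference already lies in [-1, 1] and
  -- the truncation is inactive.
  rw [softBit, min_eq_right (by linarith), max_eq_right (by linarith)]
  rw [← ENNReal.ofReal_toReal ha]
  congr 1
  rw [ENNReal.ofReal_toReal ha]
  linarith

lemma law_eq (x : ℤˣ) :
    W.law x = W.ref.withDensity fun y => ENNReal.ofReal (1 + sgn x * W.softBit y) := by
  have hm : Measurable fun y => ENNReal.ofReal (1 + W.softBit y) :=
    (W.measurable_softBit.const_add 1).ennreal_ofReal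
  rcases Int.units_eq_one_or x with rfl | rfl
  · simpa using W.law_one_eq
  · rw [law_neg_one]
    nth_rw 1 [law_one_eq]
    rw [W.withDensity_neg hm]
    simp [softBit_neg]

lemma one_add_mul_softBit_nonneg {s : ℝ} (hs : |s| ≤ 1) (y : ℝ) : 0 ≤ 1 + s * W.softBit y := by
  have : |s * W.softBit y| ≤ 1 := by
    rw [abs_mul]; exact mul_le_one₀ hs (abs_nonneg _) (W.abs_softBit_le y)
  linarith [(abs_le.1 this).1]

lemma lintegral_law (x : ℤˣ) {H : ℝ → ℝ≥0∞} (hH : Measurable H) :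
    ∫⁻ y, H y ∂W.law x = ∫⁻ y, ENNReal.ofReal (1 + sgn x * W.softBit y) * H y ∂W.ref := by
  have := W.measurable_softBit
  rw [law_eq, lintegral_withDensity_eq_lintegral_mul _ (by fun_prop) hH]
  rfl

lemma integral_softBit : ∫ y, W.softBit y ∂W.ref = 0 := by
  have h := W.bddMeas_softBit.integral_comp W.measurePreserving_neg
  simp_rw [softBit_neg] at h
  rw [integral_neg] at h
  linarith

/-- The mutual information, in nats, between a uniform input and the output. -/
noncomputable def uniformInfo : ℝ :=
  ∫ y, (1 + W.softBit y) * Real.log (1 + W.softBit y) ∂W.ref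

lemma bddMeas_mul_log (x : ℤˣ) :
    BddMeas fun y => (1 + sgn x * W.softBit y) * Real.log (1 + sgn x * W.softBit y) :=
  BddMeas.continuous_comp Real.continuous_mul_log
    ((BddMeas.const 1).add (W.bddMeas_softBit.const_mul _))

lemma integral_mul_log (x : ℤˣ) :
    ∫ y, (1 + sgn x * W.softBit y) * Real.log (1 + sgn x * W.softBit y) ∂W.ref =
      W.uniformInfo := by
  rcases Int.units_eq_one_or x with rfl | rfl
  · simp [uniformInfo]
  · have h := (W.bddMeas_mul_log 1).integral_comp W.measurePreserving_neg
    simpa [softBit_neg, uniformInfo] using h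

/-! ### The capacity is at most the information of a uniform input -/

instance (p : unitInterval) : IsProbabilityMeasure (W.joint p) := by
  refine ⟨?_⟩
  simp only [joint, Measure.add_apply, Measure.smul_apply, measure_univ, smul_eq_mul, mul_one]
  rw [← ENNReal.ofReal_add p.2.1 (by linarith [p.2.2])]
  simp

lemma joint_fst (p : unitInterval) : (W.joint p).fst =
    ENNReal.ofReal p • Measure.dirac 1 + ENNReal.ofReal (1 - p) • Measure.dirac (-1) := by
  simp [joint, Measure.fst, Measure.map_add _ _ measurable_fst, Measure.map_smul]

lemma joint_snd (p : unitInterval) : (W.joint p).snd =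
    ENNReal.ofReal p • W.law 1 + ENNReal.ofReal (1 - p) • W.law (-1) := by
  simp [joint, Measure.snd, Measure.map_add _ _ measurable_snd, Measure.map_smul]

lemma ofReal_mix {p : ℝ} (hp : 0 ≤ p) (hp' : p ≤ 1) (y : ℝ) :
    ENNReal.ofReal p * ENNReal.ofReal (1 + W.softBit y) +
      ENNReal.ofReal (1 - p) * ENNReal.ofReal (1 - W.softBit y) =
      ENNReal.ofReal (1 + (2 * p - 1) * W.softBit y) := by
  obtain ⟨h1, h2⟩ := abs_le.1 (W.abs_softBit_le y)
  rw [← ENNReal.ofReal_mul hp, ← ENNReal.ofReal_mul (by linarith), ← ENNReal.ofReal_add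
    (mul_nonneg hp (by linarith)) (mul_nonneg (by linarith) (by linarith))]
  congr 1; ring

lemma lintegral_joint_snd (p : unitInterval) {H : ℝ → ℝ≥0∞} (hH : Measurable H) :
    ∫⁻ y, H y ∂(W.joint p).snd =
      ∫⁻ y, ENNReal.ofReal (1 + (2 * p - 1) * W.softBit y) * H y ∂W.ref := by
  have := W.measurable_softBit
  rw [joint_snd, lintegral_add_measure, lintegral_smul_measure, lintegral_smul_measure,
    lintegral_law _ _ hH, lintegral_law _ _ hH, smul_eq_mul, smul_eq_mul,
    ← lintegral_const_mul _ (by fun_prop), ← lintegral_const_mul _ (by fun_prop),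
    ← lintegral_add_left (by fun_prop)]
  refine lintegral_congr fun y => ?_
  rw [← W.ofReal_mix p.2.1 p.2.2]
  simp only [sgn_one, sgn_neg, one_mul, neg_mul, ← sub_eq_add_neg]
  ring

lemma lintegral_joint (p : unitInterval) {H : ℝ × ℝ → ℝ≥0∞} (hH : Measurable H) :
    ∫⁻ ω, H ω ∂W.joint p =
      ENNReal.ofReal p * ∫⁻ y, ENNReal.ofReal (1 + W.softBit y) * H (1, y) ∂W.ref +
      ENNReal.ofReal (1 - p) * ∫⁻ y, ENNReal.ofReal (1 - W.softBit y) * H (-1, y) ∂W.ref := by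
  rw [joint, lintegral_add_measure, lintegral_smul_measure, lintegral_smul_measure,
    Measure.dirac_prod, Measure.dirac_prod, lintegral_map hH (by fun_prop),
    lintegral_map hH (by fun_prop), lintegral_law _ _ (by fun_prop), lintegral_law _ _ (by fun_prop)]
  simp [sub_eq_add_neg]

lemma lintegral_marginals (p : unitInterval) {H : ℝ × ℝ → ℝ≥0∞} (hH : Measurable H) :
    ∫⁻ ω, H ω ∂((W.joint p).fst.prod (W.joint p).snd) =
      ENNReal.ofReal p *
        ∫⁻ y, ENNReal.ofReal (1 + (2 * p - 1) * W.softBit y) * H (1, y) ∂W.ref +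
      ENNReal.ofReal (1 - p) *
        ∫⁻ y, ENNReal.ofReal (1 + (2 * p - 1) * W.softBit y) * H (-1, y) ∂W.ref := by
  rw [lintegral_prod _ hH.aemeasurable, joint_fst, lintegral_add_measure, lintegral_smul_measure,
    lintegral_smul_measure, lintegral_dirac, lintegral_dirac, lintegral_joint_snd _ _ (by fun_prop),
    lintegral_joint_snd _ _ (by fun_prop)]
  rfl

/-- The density of the joint law with respect to the product of its marginals. -/
noncomputable def infoDensity (p : ℝ) (ω : ℝ × ℝ) : ℝ :=
  (1 + ω.1 * W.softBit ω.2) / (1 + (2 * p - 1) * W.softBit ω.2)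

lemma measurable_infoDensity (p : ℝ) : Measurable (W.infoDensity p) := by
  have := W.measurable_softBit
  unfold infoDensity
  fun_prop

lemma mix_nonneg {p : ℝ} (hp : 0 ≤ p) (hp' : p ≤ 1) (y : ℝ) :
    0 ≤ 1 + (2 * p - 1) * W.softBit y :=
  W.one_add_mul_softBit_nonneg (abs_le.2 ⟨by linarith, by linarith⟩) y

/-- The mixture density is the sum of these two nonnegative terms. Hence the division by zero in
`infoDensity` occurs only where the joint law has no mass. -/
lemma mix_eq_zero {p : ℝ} (hp : 0 ≤ p) (hp' : p ≤ 1) {y : ℝ}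
    (h : 1 + (2 * p - 1) * W.softBit y = 0) :
    p * (1 + W.softBit y) = 0 ∧ (1 - p) * (1 - W.softBit y) = 0 := by
  obtain ⟨h1, h2⟩ := abs_le.1 (W.abs_softBit_le y)
  have h3 : 0 ≤ p * (1 + W.softBit y) := mul_nonneg hp (by linarith)
  have h4 : 0 ≤ (1 - p) * (1 - W.softBit y) := mul_nonneg (by linarith) (by linarith)
  constructor <;> nlinarith

lemma joint_eq_withDensity (p : unitInterval) :
    W.joint p = ((W.joint p).fst.prod (W.joint p).snd).withDensity
      fun ω => ENNReal.ofReal (W.infoDensity p ω) := by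
  have hs := W.measurable_softBit
  have hm := W.measurable_infoDensity p
  refine Measure.ext_of_lintegral _ fun H hH => ?_
  rw [lintegral_withDensity_eq_lintegral_mul _ (by fun_prop) hH, lintegral_joint _ _ hH,
    lintegral_marginals _ _ (by fun_prop)]
  simp only [Pi.mul_apply]
  have key : ∀ c s : ℝ, 0 ≤ c → (∀ y, 1 + (2 * p - 1) * W.softBit y = 0 →
      c * (1 + s * W.softBit y) = 0) → ∀ y : ℝ,
      ENNReal.ofReal c * (ENNReal.ofReal (1 + s * W.softBit y) * H (s, y)) =
      ENNReal.ofReal c * (ENNReal.ofReal (1 + (2 * p - 1) * W.softBit y) *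
        (ENNReal.ofReal (W.infoDensity p (s, y)) * H (s, y))) := by
    intro c s hc h y
    have hn := W.mix_nonneg p.2.1 p.2.2 y
    simp only [← mul_assoc]
    congr 1
    rw [← ENNReal.ofReal_mul hc, ← ENNReal.ofReal_mul hc,
      ← ENNReal.ofReal_mul (mul_nonneg hc hn)]
    congr 1
    unfold infoDensity
    by_cases h0 : 1 + (2 * (p : ℝ) - 1) * W.softBit y = 0
    · simp only [h y h0, h0, mul_zero, zero_mul]
    · rw [mul_assoc c, mul_div_cancel₀ _ h0]
  have k1 := key p 1 p.2.1 fun y h => by simpa using (W.mix_eq_zero p.2.1 p.2.2 h).1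
  have k2 := key (1 - p) (-1) (by linarith [p.2.2]) fun y h => by
    simpa [← sub_eq_add_neg] using (W.mix_eq_zero p.2.1 p.2.2 h).2
  congr 1
  · rw [← lintegral_const_mul _ (by fun_prop), ← lintegral_const_mul _ (by fun_prop)]
    exact lintegral_congr fun y => by simpa using k1 y
  · rw [← lintegral_const_mul _ (by fun_prop), ← lintegral_const_mul _ (by fun_prop)]
    exact lintegral_congr fun y => by simpa [← sub_eq_add_neg] using k2 y

lemma mul_klFun_div {u D : ℝ} (hu : 0 ≤ u) (hD : 0 < D) :
    D * InformationTheory.klFun (u / D) = u * Real.log u - u * Real.log D + D - u := by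
  rw [InformationTheory.klFun_apply]
  rcases hu.eq_or_lt with rfl | hu
  · simp
  · rw [Real.log_div hu.ne' hD.ne']
    field_simp

/-- The mutual information of input bias `p` is the mean divergence of the two output laws from the
reference, minus the divergence of the output mixture from it. Pointwise the gap is `klFun` of the
mixture density, which is nonnegative; the correction linear in `softBit` integrates to 0. -/
lemma klFun_mix_le {p : ℝ} (hp : 0 ≤ p) (hp' : p ≤ 1) (y : ℝ) :
    p * ((1 + (2 * p - 1) * W.softBit y) * InformationTheory.klFun (W.infoDensity p (1, y))) +
      (1 - p) * ((1 + (2 * p - 1) * W.softBit y) *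
        InformationTheory.klFun (W.infoDensity p (-1, y))) ≤
    p * ((1 + W.softBit y) * Real.log (1 + W.softBit y)) +
      (1 - p) * ((1 - W.softBit y) * Real.log (1 - W.softBit y)) - (2 * p - 1) * W.softBit y := by
  obtain ⟨h1, h2⟩ := abs_le.1 (W.abs_softBit_le y)
  rcases (W.mix_nonneg hp hp' y).eq_or_lt with h0 | h0
  · obtain ⟨h3, h4⟩ := W.mix_eq_zero hp hp' h0.symm
    rw [← h0, ← mul_assoc, ← mul_assoc, ← mul_assoc, ← mul_assoc, h3, h4]
    nlinarith
  · have e1 : W.infoDensity p (1, y) = (1 + W.softBit y) / (1 + (2 * p - 1) * W.softBit y) := by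
      simp [infoDensity]
    have e2 : W.infoDensity p (-1, y) = (1 - W.softBit y) / (1 + (2 * p - 1) * W.softBit y) := by
      simp [infoDensity, sub_eq_add_neg]
    rw [e1, e2, mul_klFun_div (by linarith) h0, mul_klFun_div (by linarith) h0]
    have h5 := InformationTheory.klFun_nonneg h0.le
    rw [InformationTheory.klFun_apply] at h5
    generalize Real.log (1 + (2 * p - 1) * W.softBit y) = l at *
    nlinarith

lemma mutualInfo_joint_le (p : unitInterval) :
    mutualInfo (W.joint p) ≤ ENNReal.ofReal W.uniformInfo := by
  have hs := W.measurable_softBit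
  have hm := W.measurable_infoDensity p
  have hk := InformationTheory.measurable_klFun
  have hac : W.joint p ≪ (W.joint p).fst.prod (W.joint p).snd := by
    nth_rw 1 [joint_eq_withDensity]
    exact withDensity_absolutelyContinuous _ _
  have hrn : (W.joint p).rnDeriv ((W.joint p).fst.prod (W.joint p).snd) =ᵐ[
      (W.joint p).fst.prod (W.joint p).snd] fun ω => ENNReal.ofReal (W.infoDensity p ω) := by
    have := Measure.rnDeriv_withDensity ((W.joint p).fst.prod (W.joint p).snd)
      (f := fun ω => ENNReal.ofReal (W.infoDensity p ω)) (by fun_prop)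
    rwa [← joint_eq_withDensity] at this
  have hdens : ∀ s : ℝ, |s| ≤ 1 → ∀ y, 0 ≤ W.infoDensity p (s, y) := fun s hs y =>
    div_nonneg (W.one_add_mul_softBit_nonneg hs y) (W.mix_nonneg p.2.1 p.2.2 y)
  have hp' : (0 : ℝ) ≤ 1 - p := by linarith [p.2.2]
  rw [mutualInfo, InformationTheory.klDiv_eq_lintegral_klFun_of_ac hac]
  have e1 : ∫⁻ ω, ENNReal.ofReal (InformationTheory.klFun
      (((W.joint p).rnDeriv ((W.joint p).fst.prod (W.joint p).snd) ω).toReal))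
        ∂((W.joint p).fst.prod (W.joint p).snd) =
      ∫⁻ ω, ENNReal.ofReal (InformationTheory.klFun (ENNReal.ofReal (W.infoDensity p ω)).toReal)
        ∂((W.joint p).fst.prod (W.joint p).snd) := by
    refine lintegral_congr_ae ?_
    filter_upwards [hrn] with ω hω
    rw [hω]
  rw [e1, lintegral_marginals _ _ (by fun_prop), ← lintegral_const_mul _ (by fun_prop),
    ← lintegral_const_mul _ (by fun_prop), ← lintegral_add_left (by fun_prop)]
  have b1 := W.bddMeas_mul_log 1
  have b2 := W.bddMeas_mul_log (-1)
  have i1 := W.integral_mul_log 1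
  have i2 := W.integral_mul_log (-1)
  simp only [sgn_neg, sgn_one, one_mul, neg_mul, ← sub_eq_add_neg] at b1 b2 i1 i2
  have hb := ((b1.const_mul p).add (b2.const_mul (1 - p))).sub
    (W.bddMeas_softBit.const_mul (2 * p - 1))
  have hle := W.klFun_mix_le p.2.1 p.2.2
  have hnn : ∀ y, 0 ≤ (p : ℝ) * ((1 + (2 * p - 1) * W.softBit y) *
      InformationTheory.klFun (W.infoDensity p (1, y))) := fun y =>
    mul_nonneg p.2.1 (mul_nonneg (W.mix_nonneg p.2.1 p.2.2 y)
      (InformationTheory.klFun_nonneg (hdens _ (by simp) y)))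
  have hnn' : ∀ y, 0 ≤ (1 - p : ℝ) * ((1 + (2 * p - 1) * W.softBit y) *
      InformationTheory.klFun (W.infoDensity p (-1, y))) := fun y =>
    mul_nonneg hp' (mul_nonneg (W.mix_nonneg p.2.1 p.2.2 y)
      (InformationTheory.klFun_nonneg (hdens _ (by simp) y)))
  have e2 : W.uniformInfo = ∫ y, (p * ((1 + W.softBit y) * Real.log (1 + W.softBit y)) +
      (1 - p) * ((1 - W.softBit y) * Real.log (1 - W.softBit y)) - (2 * p - 1) * W.softBit y)
        ∂W.ref := by
    rw [integral_sub (((b1.const_mul p).add (b2.const_mul (1 - p))).integrable _)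
        ((W.bddMeas_softBit.const_mul _).integrable _),
      integral_add ((b1.const_mul p).integrable _) ((b2.const_mul (1 - p)).integrable _),
      integral_const_mul, integral_const_mul, integral_const_mul, i1, i2, integral_softBit]
    ring
  rw [e2, ofReal_integral_eq_lintegral_ofReal (hb.integrable _)
    (Filter.Eventually.of_forall fun y => ((add_nonneg (hnn y) (hnn' y)).trans (hle y)))]
  refine lintegral_mono fun y => ?_
  have hn := W.mix_nonneg p.2.1 p.2.2 y
  dsimp only
  rw [ENNReal.toReal_ofReal (hdens _ (by simp) y), ENNReal.toReal_ofReal (hdens _ (by simp) y),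
    ← ENNReal.ofReal_mul hn, ← ENNReal.ofReal_mul hn, ← ENNReal.ofReal_mul p.2.1,
    ← ENNReal.ofReal_mul hp', ← ENNReal.ofReal_add (hnn y) (hnn' y)]
  exact ENNReal.ofReal_le_ofReal (hle y)

lemma uniformInfo_nonneg : 0 ≤ W.uniformInfo := by
  have h : 0 ≤ ∫ y, ((1 + W.softBit y) * Real.log (1 + W.softBit y) - W.softBit y) ∂W.ref := by
    refine integral_nonneg fun y => ?_
    have h0 := W.one_add_mul_softBit_nonneg (s := 1) (by simp) y
    rw [one_mul] at h0
    have := InformationTheory.klFun_nonneg h0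
    rw [InformationTheory.klFun_apply] at this
    show 0 ≤ _
    linarith
  have b1 := W.bddMeas_mul_log 1
  simp only [sgn_one, one_mul] at b1
  rw [integral_sub (b1.integrable _) (W.bddMeas_softBit.integrable _), integral_softBit] at h
  simpa [uniformInfo] using h

lemma capacity_mul_log_two_le : W.capacity * Real.log 2 ≤ W.uniformInfo := by
  rw [capacity, div_mul_cancel₀ _ (Real.log_pos one_lt_two).ne']
  exact ENNReal.toReal_le_of_le_ofReal W.uniformInfo_nonneg (iSup_le W.mutualInfo_joint_le)

end BMSChannel

/-! ### Likelihoods and soft estimates of a code -/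

/-- The BPSK symbol of a bit, as a real number. -/
noncomputable def chi (u : ZMod 2) : ℝ := sgn (bpsk u)

lemma bpsk_add : ∀ u v : ZMod 2, bpsk (u + v) = bpsk u * bpsk v := by decide

lemma chi_add (u v : ZMod 2) : chi (u + v) = chi u * chi v := by
  rw [chi, bpsk_add, sgn_mul, chi, chi]

lemma chi_eq_or (u : ZMod 2) : chi u = 1 ∨ chi u = -1 := sgn_eq_or _

lemma chi_mul_self (u : ZMod 2) : chi u * chi u = 1 := by
  rcases chi_eq_or u with h | h <;> simp [h]

lemma abs_chi (u : ZMod 2) : |chi u| = 1 := by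
  rcases chi_eq_or u with h | h <;> simp [h]

noncomputable instance Code.instFintype {N : ℕ} (𝒞 : Code N) : Fintype 𝒞 := Fintype.ofFinite 𝒞

lemma card_code_pos {N : ℕ} (𝒞 : Code N) : (0 : ℝ) < Nat.card 𝒞 := by
  exact_mod_cast Nat.card_pos

section Code

variable {N : ℕ}

/-- The law of `N` independent channel outputs for uniform inputs. -/
noncomputable abbrev BMSChannel.refPi (W : BMSChannel) (N : ℕ) : Measure (Fin N → ℝ) :=
  Measure.pi fun _ => W.ref

/-- Change the sign of one coordinate. -/
def flip (j : Fin N) (y : Fin N → ℝ) : Fin N → ℝ := Function.update y j (-y j)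

lemma flip_self (j : Fin N) (y : Fin N → ℝ) : flip j y j = -y j := by simp [flip]

lemma flip_of_ne {i j : Fin N} (h : i ≠ j) (y : Fin N → ℝ) : flip j y i = y i := by simp [flip, h]

lemma measurePreserving_flip (W : BMSChannel) (j : Fin N) :
    MeasurePreserving (flip j) (W.refPi N) (W.refPi N) := by
  have hs : ∀ i : Fin N, MeasurePreserving (if i = j then Neg.neg else id : ℝ → ℝ) W.ref W.ref := by
    intro i
    split_ifs
    · exact W.measurePreserving_neg
    · exact MeasurePreserving.id _
  convert measurePreserving_pi (fun _ : Fin N => W.ref) (fun _ : Fin N => W.ref) hs using 1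
  funext y i
  by_cases h : i = j
  · subst h; simp [flip]
  · simp [flip, h]

/-- The likelihood of the codeword `x` on the coordinates in `S`, relative to `W.refPi N`. -/
noncomputable def lik (W : BMSChannel) (S : Finset (Fin N)) (x : Fin N → ZMod 2) (y : Fin N → ℝ) :
    ℝ :=
  ∏ j ∈ S, (1 + chi (x j) * W.softBit (y j))

/-- The total likelihood of a code. -/
noncomputable def den (W : BMSChannel) (𝒞 : Code N) (S : Finset (Fin N)) (y : Fin N → ℝ) : ℝ :=
  ∑ c : 𝒞, lik W S c.1 y

/-- The total likelihood of a code, weighted by the symbol at `i`. -/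
noncomputable def num (W : BMSChannel) (𝒞 : Code N) (S : Finset (Fin N)) (i : Fin N)
    (y : Fin N → ℝ) : ℝ :=
  ∑ c : 𝒞, chi (c.1 i) * lik W S c.1 y

/-- The conditional mean of the symbol at `i` given the outputs on `S`. -/
noncomputable def softEst (W : BMSChannel) (𝒞 : Code N) (S : Finset (Fin N)) (i : Fin N)
    (y : Fin N → ℝ) : ℝ :=
  num W 𝒞 S i y / den W 𝒞 S y

section

variable (W : BMSChannel) (𝒞 : Code N)

lemma factor_nonneg (u : ZMod 2) (a : ℝ) : 0 ≤ 1 + chi u * W.softBit a :=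
  W.one_add_mul_softBit_nonneg (abs_chi u).le a

lemma lik_nonneg (S : Finset (Fin N)) (x : Fin N → ZMod 2) (y : Fin N → ℝ) : 0 ≤ lik W S x y :=
  Finset.prod_nonneg fun _ _ => factor_nonneg W _ _

lemma den_nonneg (S : Finset (Fin N)) (y : Fin N → ℝ) : 0 ≤ den W 𝒞 S y :=
  Finset.sum_nonneg fun _ _ => lik_nonneg W _ _ _

lemma abs_num_le (S : Finset (Fin N)) (i : Fin N) (y : Fin N → ℝ) :
    |num W 𝒞 S i y| ≤ den W 𝒞 S y := by
  refine (Finset.abs_sum_le_sum_abs _ _).trans (Finset.sum_le_sum fun c _ => ?_)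
  rw [abs_mul, abs_chi, one_mul, abs_of_nonneg (lik_nonneg W _ _ _)]

lemma softEst_mul_den (S : Finset (Fin N)) (i : Fin N) (y : Fin N → ℝ) :
    softEst W 𝒞 S i y * den W 𝒞 S y = num W 𝒞 S i y := by
  by_cases h : den W 𝒞 S y = 0
  · have := abs_num_le W 𝒞 S i y
    rw [h] at this
    rw [h, mul_zero, abs_nonpos_iff.1 this]
  · exact div_mul_cancel₀ _ h

lemma abs_softEst_le (S : Finset (Fin N)) (i : Fin N) (y : Fin N → ℝ) :
    |softEst W 𝒞 S i y| ≤ 1 := by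
  rw [softEst, abs_div, abs_of_nonneg (den_nonneg W 𝒞 S y)]
  exact div_le_one_of_le₀ (abs_num_le W 𝒞 S i y) (den_nonneg W 𝒞 S y)

lemma bddMeas_softBit_apply (j : Fin N) : BddMeas fun y : Fin N → ℝ => W.softBit (y j) :=
  W.bddMeas_softBit.comp (measurable_pi_apply j)

lemma bddMeas_lik (S : Finset (Fin N)) (x : Fin N → ZMod 2) : BddMeas (lik W S x) :=
  BddMeas.prod fun j _ => (BddMeas.const 1).add ((bddMeas_softBit_apply W j).const_mul _)

lemma bddMeas_den (S : Finset (Fin N)) : BddMeas (den W 𝒞 S) :=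
  BddMeas.sum fun c _ => bddMeas_lik W S c.1

lemma bddMeas_num (S : Finset (Fin N)) (i : Fin N) : BddMeas (num W 𝒞 S i) :=
  BddMeas.sum fun c _ => (bddMeas_lik W S c.1).const_mul _

lemma bddMeas_softEst (S : Finset (Fin N)) (i : Fin N) : BddMeas (softEst W 𝒞 S i) :=
  ⟨(bddMeas_num W 𝒞 S i).meas.div (bddMeas_den W 𝒞 S).meas, 1, abs_softEst_le W 𝒞 S i⟩

lemma lik_congr {S : Finset (Fin N)} (x : Fin N → ZMod 2) {y z : Fin N → ℝ}
    (h : ∀ j ∈ S, y j = z j) : lik W S x y = lik W S x z :=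
  Finset.prod_congr rfl fun j hj => by rw [h j hj]

lemma den_congr {S : Finset (Fin N)} {y z : Fin N → ℝ} (h : ∀ j ∈ S, y j = z j) :
    den W 𝒞 S y = den W 𝒞 S z :=
  Finset.sum_congr rfl fun c _ => lik_congr W c.1 h

lemma num_congr {S : Finset (Fin N)} (i : Fin N) {y z : Fin N → ℝ} (h : ∀ j ∈ S, y j = z j) :
    num W 𝒞 S i y = num W 𝒞 S i z :=
  Finset.sum_congr rfl fun c _ => by rw [lik_congr W c.1 h]

lemma softEst_congr {S : Finset (Fin N)} (i : Fin N) {y z : Fin N → ℝ} (h : ∀ j ∈ S, y j = z j) :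
    softEst W 𝒞 S i y = softEst W 𝒞 S i z := by
  rw [softEst, softEst, num_congr W 𝒞 i h, den_congr W 𝒞 h]

lemma flip_agree {S : Finset (Fin N)} {j : Fin N} (hj : j ∉ S) (y : Fin N → ℝ) :
    ∀ i ∈ S, flip j y i = y i :=
  fun _ hi => flip_of_ne (ne_of_mem_of_not_mem hi hj) y

lemma lik_insert {S : Finset (Fin N)} {j : Fin N} (hj : j ∉ S) (x : Fin N → ZMod 2)
    (y : Fin N → ℝ) :
    lik W (insert j S) x y = (1 + chi (x j) * W.softBit (y j)) * lik W S x y := by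
  rw [lik, Finset.prod_insert hj, lik]

/-- The posterior mean of the symbol at `j` is all that matters for the next output: given the
outputs on `S`, output `j` has density `1 + m * softBit` relative to the reference. -/
lemma den_insert {S : Finset (Fin N)} {j : Fin N} (hj : j ∉ S) (y : Fin N → ℝ) :
    den W 𝒞 (insert j S) y =
      den W 𝒞 S y * (1 + softEst W 𝒞 S j y * W.softBit (y j)) := by
  have : den W 𝒞 S y * (1 + softEst W 𝒞 S j y * W.softBit (y j)) =
      den W 𝒞 S y + softEst W 𝒞 S j y * den W 𝒞 S y * W.softBit (y j) := by ring
  rw [this, softEst_mul_den, den, den, num, Finset.sum_mul, ← Finset.sum_add_distrib]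
  refine Finset.sum_congr rfl fun c _ => ?_
  rw [lik_insert W hj]
  ring

lemma integral_mul_softBit_eq_zero {g : (Fin N → ℝ) → ℝ} (hg : BddMeas g) {j : Fin N}
    (h : ∀ y, g (flip j y) = g y) : ∫ y, g y * W.softBit (y j) ∂W.refPi N = 0 := by
  have := (hg.mul (bddMeas_softBit_apply W j)).integral_comp (measurePreserving_flip W j)
  simp_rw [h, flip_self, W.softBit_neg, mul_neg] at this
  rw [integral_neg] at this
  linarith

/-- Likelihood factors outside `S` integrate out one by one, because `softBit` is odd and the
remaining integrand is unchanged when that output is negated. Only invariance under sign flips is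
needed, not independence of the coordinate. -/
lemma integral_mul_lik_of_subset {g : (Fin N → ℝ) → ℝ} (hg : BddMeas g) {S S' : Finset (Fin N)}
    (hS : S ⊆ S') (h : ∀ j ∈ S', j ∉ S → ∀ y, g (flip j y) = g y) (x : Fin N → ZMod 2) :
    ∫ y, g y * lik W S' x y ∂W.refPi N = ∫ y, g y * lik W S x y ∂W.refPi N := by
  obtain ⟨R, hR, rfl⟩ : ∃ R, Disjoint S R ∧ S ∪ R = S' :=
    ⟨S' \ S, Finset.disjoint_sdiff, Finset.union_sdiff_of_subset hS⟩
  clear hS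
  induction R using Finset.induction_on with
  | empty => simp
  | insert j R hj ih =>
    have hjS : j ∉ S := fun hjS => Finset.disjoint_left.1 hR hjS (Finset.mem_insert_self _ _)
    have hjSR : j ∉ S ∪ R := by simp [hjS, hj]
    rw [← ih (hR.mono_right (Finset.subset_insert _ _))
      (fun k hk => h k (Finset.union_subset_union_right (Finset.subset_insert _ _) hk)),
      Finset.union_insert]
    have hb := hg.mul (bddMeas_lik W (S ∪ R) x)
    have h0 : ∫ y, g y * lik W (S ∪ R) x y * W.softBit (y j) ∂W.refPi N = 0 := by
      refine integral_mul_softBit_eq_zero W hb fun y => ?_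
      rw [h j (by simp) hjS, lik_congr W x (flip_agree hjSR y)]
    have e : ∀ y, g y * lik W (insert j (S ∪ R)) x y = g y * lik W (S ∪ R) x y +
        chi (x j) * (g y * lik W (S ∪ R) x y * W.softBit (y j)) := by
      intro y; rw [lik_insert W hjSR]; ring
    simp_rw [e]
    rw [integral_add (hb.integrable _)
      (((hb.mul (bddMeas_softBit_apply W j)).const_mul _).integrable _), integral_const_mul, h0,
      mul_zero, add_zero]

lemma integral_mul_den_of_subset {g : (Fin N → ℝ) → ℝ} (hg : BddMeas g) {S S' : Finset (Fin N)}
    (hS : S ⊆ S') (h : ∀ j ∈ S', j ∉ S → ∀ y, g (flip j y) = g y) :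
    ∫ y, g y * den W 𝒞 S' y ∂W.refPi N = ∫ y, g y * den W 𝒞 S y ∂W.refPi N := by
  simp_rw [den, Finset.mul_sum]
  rw [integral_finsetSum _ fun c _ => (hg.mul (bddMeas_lik W _ _)).integrable _,
    integral_finsetSum _ fun c _ => (hg.mul (bddMeas_lik W _ _)).integrable _]
  exact Finset.sum_congr rfl fun c _ => integral_mul_lik_of_subset W hg hS h c.1

lemma integral_mul_num_of_subset {g : (Fin N → ℝ) → ℝ} (hg : BddMeas g) {S S' : Finset (Fin N)}
    (hS : S ⊆ S') (h : ∀ j ∈ S', j ∉ S → ∀ y, g (flip j y) = g y) (i : Fin N) :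
    ∫ y, g y * num W 𝒞 S' i y ∂W.refPi N = ∫ y, g y * num W 𝒞 S i y ∂W.refPi N := by
  simp_rw [num, Finset.mul_sum, mul_left_comm (g _) (chi _)]
  rw [integral_finsetSum _ fun c _ => ((hg.mul (bddMeas_lik W _ _)).const_mul _).integrable _,
    integral_finsetSum _ fun c _ => ((hg.mul (bddMeas_lik W _ _)).const_mul _).integrable _]
  refine Finset.sum_congr rfl fun c _ => ?_
  rw [integral_const_mul, integral_const_mul, integral_mul_lik_of_subset W hg hS h c.1]

/-- The soft estimate is the projection of the symbol at `i` on the functions of the outputs on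
`S`. -/
lemma integral_mul_num_univ {g : (Fin N → ℝ) → ℝ} (hg : BddMeas g) {S : Finset (Fin N)}
    (h : ∀ j ∉ S, ∀ y, g (flip j y) = g y) (i : Fin N) :
    ∫ y, g y * num W 𝒞 Finset.univ i y ∂W.refPi N =
      ∫ y, g y * softEst W 𝒞 S i y * den W 𝒞 Finset.univ y ∂W.refPi N := by
  have hf : ∀ j ∈ Finset.univ, j ∉ S → ∀ y, g (flip j y) = g y := fun j _ => h j
  rw [integral_mul_num_of_subset W 𝒞 hg (Finset.subset_univ S) hf,
    integral_mul_den_of_subset W 𝒞 (hg.mul (bddMeas_softEst W 𝒞 S i)) (Finset.subset_univ S)]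
  · simp_rw [mul_assoc, softEst_mul_den]
  · intro j hj hjS y
    rw [hf j hj hjS, softEst_congr W 𝒞 i (flip_agree hjS y)]

/-- The second moment of the soft estimate. -/
noncomputable def estEnergy (S : Finset (Fin N)) (i : Fin N) : ℝ :=
  (Nat.card 𝒞 : ℝ)⁻¹ *
    ∫ y, softEst W 𝒞 S i y ^ 2 * den W 𝒞 Finset.univ y ∂W.refPi N

/-- Pythagoras: the estimate from `S` is the projection of the estimate from `S'`, so the energies
differ by the mean square of the difference of the two. -/
lemma estEnergy_mono {S S' : Finset (Fin N)} (hS : S ⊆ S') (i : Fin N) :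
    estEnergy W 𝒞 S i ≤ estEnergy W 𝒞 S' i := by
  refine mul_le_mul_of_nonneg_left ?_ (inv_nonneg.2 (card_code_pos 𝒞).le)
  have hm := bddMeas_softEst W 𝒞 S i
  have hm' := bddMeas_softEst W 𝒞 S' i
  have hd := bddMeas_den W 𝒞 Finset.univ
  have h1 := integral_mul_num_univ W 𝒞 hm (S := S)
    (fun j hj y => softEst_congr W 𝒞 i (flip_agree hj y)) i
  have h2 := integral_mul_num_univ W 𝒞 hm (S := S')
    (fun j hj y => softEst_congr W 𝒞 i (flip_agree (fun h => hj (hS h)) y)) i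
  have h3 : 0 ≤ ∫ y, (softEst W 𝒞 S' i y - softEst W 𝒞 S i y) ^ 2 * den W 𝒞 Finset.univ y
      ∂W.refPi N :=
    integral_nonneg fun y => mul_nonneg (sq_nonneg _) (den_nonneg W 𝒞 _ y)
  have e : ∀ y, (softEst W 𝒞 S' i y - softEst W 𝒞 S i y) ^ 2 * den W 𝒞 Finset.univ y =
      softEst W 𝒞 S' i y ^ 2 * den W 𝒞 Finset.univ y +
      (softEst W 𝒞 S i y ^ 2 * den W 𝒞 Finset.univ y -
        2 * (softEst W 𝒞 S i y * softEst W 𝒞 S' i y * den W 𝒞 Finset.univ y)) := by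
    intro y; ring
  simp_rw [e] at h3
  rw [integral_add (((hm'.pow 2).mul hd).integrable _)
      ((((hm.pow 2).mul hd).sub (((hm.mul hm').mul hd).const_mul 2)).integrable _),
    integral_sub (((hm.pow 2).mul hd).integrable _)
      ((((hm.mul hm').mul hd).const_mul 2).integrable _), integral_const_mul, ← h2, h1] at h3
  simp_rw [← sq] at h3
  linarith

/-! ### Entropy of the output -/

lemma mul_log_mul (a b : ℝ) :
    a * b * Real.log (a * b) = b * (a * Real.log a) + a * (b * Real.log b) := by
  have := Real.negMulLog_mul a b
  simp only [Real.negMulLog] at this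
  linarith

/-- The divergence of the law of the outputs on `S` from the reference measure. -/
noncomputable def outDiv (S : Finset (Fin N)) : ℝ :=
  ∫ y, ((Nat.card 𝒞 : ℝ)⁻¹ * den W 𝒞 S y) * Real.log ((Nat.card 𝒞 : ℝ)⁻¹ * den W 𝒞 S y)
    ∂W.refPi N

lemma outDiv_empty : outDiv W 𝒞 ∅ = 0 := by
  have h := (card_code_pos 𝒞).ne'
  have : ∀ y, (Nat.card 𝒞 : ℝ)⁻¹ * den W 𝒞 ∅ y = 1 := by
    intro y
    rw [Nat.card_eq_fintype_card] at h ⊢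
    simp [den, lik, h]
  simp_rw [outDiv, this]
  simp

/-- Chain rule: the increment is the mean of (1+mt)log(1+mt), with m the current estimate and t the
new soft bit. Symmetrizing in the sign of t turns it into half an entropy deficit, at most m² log 2.
-/
lemma outDiv_insert_le {S : Finset (Fin N)} {i : Fin N} (hi : i ∉ S) :
    outDiv W 𝒞 (insert i S) ≤ outDiv W 𝒞 S + Real.log 2 * estEnergy W 𝒞 S i := by
  set K : ℝ := (Nat.card 𝒞 : ℝ)⁻¹ with hK
  have hK0 : 0 ≤ K := inv_nonneg.2 (card_code_pos 𝒞).le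
  set m := softEst W 𝒞 S i with hm
  have bm : BddMeas m := bddMeas_softEst W 𝒞 S i
  have bZ : BddMeas fun y => K * den W 𝒞 S y := (bddMeas_den W 𝒞 S).const_mul K
  have bt := bddMeas_softBit_apply W i
  have bL : BddMeas fun y => (K * den W 𝒞 S y) * Real.log (K * den W 𝒞 S y) :=
    BddMeas.continuous_comp Real.continuous_mul_log bZ
  have bE : BddMeas fun y => (1 + m y * W.softBit (y i)) * Real.log (1 + m y * W.softBit (y i)) :=
    BddMeas.continuous_comp Real.continuous_mul_log ((BddMeas.const 1).add (bm.mul bt))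
  have fm : ∀ y, m (flip i y) = m y := fun y => softEst_congr W 𝒞 i (flip_agree hi y)
  have fd : ∀ y, den W 𝒞 S (flip i y) = den W 𝒞 S y := fun y => den_congr W 𝒞 (flip_agree hi y)
  have e1 : ∀ y, (K * den W 𝒞 (insert i S) y) * Real.log (K * den W 𝒞 (insert i S) y) =
      (K * den W 𝒞 S y) * Real.log (K * den W 𝒞 S y) +
      (m y * ((K * den W 𝒞 S y) * Real.log (K * den W 𝒞 S y)) * W.softBit (y i) +
      (K * den W 𝒞 S y) *
        ((1 + m y * W.softBit (y i)) * Real.log (1 + m y * W.softBit (y i)))) := by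
    intro y
    rw [den_insert W 𝒞 hi, ← mul_assoc, mul_log_mul]
    ring
  have z1 : ∫ y, m y * ((K * den W 𝒞 S y) * Real.log (K * den W 𝒞 S y)) * W.softBit (y i)
      ∂W.refPi N = 0 :=
    integral_mul_softBit_eq_zero W (bm.mul bL) fun y => by rw [fm, fd]
  -- Negating output `i` fixes `m` and the density on `S` but changes the sign of the soft bit, so
  -- the integrals with `1 + m t` and `1 - m t` are equal.
  have e2 := (bZ.mul bE).integral_comp (measurePreserving_flip W i)
  simp_rw [fm, fd, flip_self, W.softBit_neg, mul_neg, ← sub_eq_add_neg] at e2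
  have bE' : BddMeas fun y => (1 - m y * W.softBit (y i)) * Real.log (1 - m y * W.softBit (y i)) :=
    BddMeas.continuous_comp Real.continuous_mul_log ((BddMeas.const 1).sub (bm.mul bt))
  have e3 : (∫ y, (K * den W 𝒞 S y) *
        ((1 + m y * W.softBit (y i)) * Real.log (1 + m y * W.softBit (y i))) ∂W.refPi N) +
      (∫ y, (K * den W 𝒞 S y) *
        ((1 - m y * W.softBit (y i)) * Real.log (1 - m y * W.softBit (y i))) ∂W.refPi N) ≤
      ∫ y, 2 * Real.log 2 * K * (m y ^ 2 * den W 𝒞 S y) ∂W.refPi N := by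
    rw [← integral_add ((bZ.mul bE).integrable _) ((bZ.mul bE').integrable _)]
    refine integral_mono (((bZ.mul bE).add (bZ.mul bE')).integrable _)
      ((((bm.pow 2).mul (bddMeas_den W 𝒞 S)).const_mul _).integrable _) fun y => ?_
    have hmt : |m y * W.softBit (y i)| ≤ 1 := by
      rw [abs_mul]
      exact mul_le_one₀ (abs_softEst_le W 𝒞 S i y) (abs_nonneg _) (W.abs_softBit_le _)
    have hd : 0 ≤ K * den W 𝒞 S y := mul_nonneg hK0 (den_nonneg W 𝒞 S y)
    have ht : (m y * W.softBit (y i)) ^ 2 ≤ m y ^ 2 := by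
      rw [mul_pow]
      exact mul_le_of_le_one_right (sq_nonneg _)
        ((sq_le_one_iff_abs_le_one _).2 (W.abs_softBit_le _))
    have hl := Real.log_pos one_lt_two
    calc _ = (K * den W 𝒞 S y) *
          ((1 + m y * W.softBit (y i)) * Real.log (1 + m y * W.softBit (y i)) +
          (1 - m y * W.softBit (y i)) * Real.log (1 - m y * W.softBit (y i))) := by ring
      _ ≤ (K * den W 𝒞 S y) * (2 * Real.log 2 * m y ^ 2) := by
          refine mul_le_mul_of_nonneg_left ((entropy_deficit_le hmt).trans ?_) hd
          gcongr
      _ = _ := by ring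
  have e4 : ∫ y, 2 * Real.log 2 * K * (m y ^ 2 * den W 𝒞 S y) ∂W.refPi N =
      2 * Real.log 2 * estEnergy W 𝒞 S i := by
    rw [integral_const_mul, estEnergy, integral_mul_den_of_subset W 𝒞 (bm.pow 2)
      (Finset.subset_univ S) fun j _ hj y => by rw [hm, softEst_congr W 𝒞 i (flip_agree hj y)]]
    ring
  rw [outDiv, outDiv]
  simp_rw [← hK, e1]
  rw [integral_add (bL.integrable _) (((bm.mul bL).mul bt |>.add (bZ.mul bE)).integrable _),
    integral_add (((bm.mul bL).mul bt).integrable _) ((bZ.mul bE).integrable _), z1]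
  linarith

lemma outDiv_le (S : Finset (Fin N)) :
    outDiv W 𝒞 S ≤ Real.log 2 * ∑ i ∈ S, estEnergy W 𝒞 (Finset.univ.erase i) i := by
  induction S using Finset.induction_on with
  | empty => simp [outDiv_empty]
  | insert i S hi ih =>
    refine (outDiv_insert_le W 𝒞 hi).trans ?_
    have h1 : estEnergy W 𝒞 S i ≤ estEnergy W 𝒞 (Finset.univ.erase i) i :=
      estEnergy_mono W 𝒞 (fun j hj => Finset.mem_erase.2 ⟨ne_of_mem_of_not_mem hj hi, Finset.mem_univ j⟩) i
    have h2 := mul_le_mul_of_nonneg_left h1 (Real.log_pos one_lt_two).le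
    rw [Finset.sum_insert hi, mul_add]
    linarith

lemma integral_lik_mul_log (S : Finset (Fin N)) (x : Fin N → ZMod 2) :
    ∫ y, lik W S x y * Real.log (lik W S x y) ∂W.refPi N = S.card * W.uniformInfo := by
  induction S using Finset.induction_on with
  | empty => simp [lik]
  | insert j S hj ih =>
    have bl := bddMeas_lik W S x
    have bt := bddMeas_softBit_apply W j
    have bL : BddMeas fun y => lik W S x y * Real.log (lik W S x y) :=
      BddMeas.continuous_comp Real.continuous_mul_log bl
    have bF : BddMeas fun y : Fin N → ℝ => (1 + chi (x j) * W.softBit (y j)) *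
        Real.log (1 + chi (x j) * W.softBit (y j)) :=
      (W.bddMeas_mul_log (bpsk (x j))).comp (measurable_pi_apply j)
    have e1 : ∀ y, lik W (insert j S) x y * Real.log (lik W (insert j S) x y) =
        (1 + chi (x j) * W.softBit (y j)) * Real.log (1 + chi (x j) * W.softBit (y j)) *
          lik W S x y + (lik W S x y * Real.log (lik W S x y) +
        chi (x j) * (lik W S x y * Real.log (lik W S x y) * W.softBit (y j))) := by
      intro y
      rw [lik_insert W hj, mul_log_mul]
      ring
    have z : ∫ y, lik W S x y * Real.log (lik W S x y) * W.softBit (y j) ∂W.refPi N = 0 :=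
      integral_mul_softBit_eq_zero W bL fun y => by rw [lik_congr W x (flip_agree hj y)]
    have i1 : ∫ y, (1 + chi (x j) * W.softBit (y j)) *
        Real.log (1 + chi (x j) * W.softBit (y j)) * lik W S x y ∂W.refPi N = W.uniformInfo := by
      rw [integral_mul_lik_of_subset W bF (Finset.empty_subset S) fun k hk _ y => by
        rw [flip_of_ne (ne_of_mem_of_not_mem hk hj).symm]]
      simp only [lik, Finset.prod_empty, mul_one]
      exact ((W.bddMeas_mul_log (bpsk (x j))).integral_comp
        (measurePreserving_eval (fun _ : Fin N => W.ref) j)).trans (W.integral_mul_log _)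
    simp_rw [e1]
    rw [integral_add ((bF.mul bl).integrable _) ((bL.add ((bL.mul bt).const_mul _)).integrable _),
      integral_add (bL.integrable _) (((bL.mul bt).const_mul _).integrable _), integral_const_mul,
      z, i1, ih, Finset.card_insert_of_notMem hj]
    push_cast
    ring

/-- This is I(X;Y) ≤ log|𝒞|: in the logarithm, the total likelihood is at least that of each single
codeword, and each codeword contributes `N * uniformInfo` by the product structure. -/
lemma le_outDiv_univ :
    N * W.uniformInfo - Real.log (Nat.card 𝒞) ≤ outDiv W 𝒞 Finset.univ := by
  set K : ℝ := (Nat.card 𝒞 : ℝ)⁻¹ with hK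
  have hc := card_code_pos 𝒞
  have hK0 : 0 < K := inv_pos.2 hc
  have bL : ∀ x : Fin N → ZMod 2, BddMeas fun y =>
      lik W Finset.univ x y * Real.log (lik W Finset.univ x y) := fun x =>
    BddMeas.continuous_comp Real.continuous_mul_log (bddMeas_lik W _ x)
  have hpt : ∀ y, ∑ c : 𝒞, K * (lik W Finset.univ c.1 y * Real.log (lik W Finset.univ c.1 y) +
        Real.log K * lik W Finset.univ c.1 y) ≤
      (K * den W 𝒞 Finset.univ y) * Real.log (K * den W 𝒞 Finset.univ y) := by
    intro y
    have : (K * den W 𝒞 Finset.univ y) * Real.log (K * den W 𝒞 Finset.univ y) =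
        ∑ c : 𝒞, K * (lik W Finset.univ c.1 y * Real.log (K * den W 𝒞 Finset.univ y)) := by
      rw [← Finset.mul_sum, ← Finset.sum_mul, ← mul_assoc]; rfl
    rw [this]
    refine Finset.sum_le_sum fun c _ => mul_le_mul_of_nonneg_left ?_ hK0.le
    rcases (lik_nonneg W Finset.univ c.1 y).eq_or_lt with h0 | h0
    · simp [← h0]
    · have hle : lik W Finset.univ c.1 y ≤ den W 𝒞 Finset.univ y :=
        Finset.single_le_sum (f := fun c : 𝒞 => lik W Finset.univ c.1 y)
          (fun c _ => lik_nonneg W _ c.1 y) (Finset.mem_univ c)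
      rw [mul_comm (Real.log K), ← mul_add, ← Real.log_mul h0.ne' hK0.ne', mul_comm _ K]
      exact mul_le_mul_of_nonneg_left (Real.log_le_log (mul_pos hK0 h0)
        (mul_le_mul_of_nonneg_left hle hK0.le)) h0.le
  have bS : ∀ c : 𝒞, BddMeas fun y => K * (lik W Finset.univ c.1 y *
      Real.log (lik W Finset.univ c.1 y) + Real.log K * lik W Finset.univ c.1 y) := fun c =>
    ((bL c.1).add ((bddMeas_lik W _ c.1).const_mul _)).const_mul K
  have h1 : ∀ x : Fin N → ZMod 2, ∫ y, lik W Finset.univ x y ∂W.refPi N = 1 := by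
    intro x
    have := integral_mul_lik_of_subset W (BddMeas.const 1) (Finset.empty_subset Finset.univ)
      (fun _ _ _ _ => rfl) x
    simpa [lik] using this
  have h2 : ∫ y, ∑ c : 𝒞, K * (lik W Finset.univ c.1 y * Real.log (lik W Finset.univ c.1 y) +
        Real.log K * lik W Finset.univ c.1 y) ∂W.refPi N =
      N * W.uniformInfo - Real.log (Nat.card 𝒞) := by
    rw [integral_finsetSum _ fun c _ => (bS c).integrable _]
    have : ∀ c : 𝒞, ∫ y, K * (lik W Finset.univ c.1 y * Real.log (lik W Finset.univ c.1 y) +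
        Real.log K * lik W Finset.univ c.1 y) ∂W.refPi N =
        K * (N * W.uniformInfo - Real.log (Nat.card 𝒞)) := by
      intro c
      rw [integral_const_mul, integral_add ((bL c.1).integrable _)
        (((bddMeas_lik W _ c.1).const_mul _).integrable _), integral_const_mul,
        integral_lik_mul_log, h1, hK, Real.log_inv, Finset.card_univ, Fintype.card_fin]
      ring
    rw [Finset.sum_congr rfl fun c _ => this c, Finset.sum_const, Finset.card_univ, nsmul_eq_mul,
      ← Nat.card_eq_fintype_card, ← mul_assoc, hK, mul_inv_cancel₀ hc.ne', one_mul]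
  rw [← h2, outDiv]
  exact integral_mono ((BddMeas.sum fun c _ => bS c).integrable _)
    ((BddMeas.continuous_comp Real.continuous_mul_log
      ((bddMeas_den W 𝒞 Finset.univ).const_mul K)).integrable _) hpt

/-! ### Symmetries of the code -/

variable {𝒞}

/-- The permutation of the codewords induced by an automorphism. -/
def codePerm {π : Equiv.Perm (Fin N)} (hπ : π ∈ autGroup 𝒞) : 𝒞 ≃ 𝒞 where
  toFun c := ⟨fun i => c.1 (π⁻¹ i), hπ c.1 c.2⟩
  invFun c := ⟨fun i => c.1 (π⁻¹⁻¹ i), (autGroup 𝒞).inv_mem hπ c.1 c.2⟩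
  left_inv c := by ext i; simp
  right_inv c := by ext i; simp

lemma lik_comp_perm (π : Equiv.Perm (Fin N)) (S : Finset (Fin N)) (x : Fin N → ZMod 2)
    (y : Fin N → ℝ) :
    lik W S x (fun i => y (π i)) = lik W (S.map π.toEmbedding) (fun i => x (π⁻¹ i)) y := by
  simp [lik]

lemma den_comp_perm {π : Equiv.Perm (Fin N)} (hπ : π ∈ autGroup 𝒞) (S : Finset (Fin N))
    (y : Fin N → ℝ) :
    den W 𝒞 S (fun i => y (π i)) = den W 𝒞 (S.map π.toEmbedding) y :=
  Fintype.sum_equiv (codePerm hπ) _ _ fun c => lik_comp_perm W π S c.1 y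

lemma num_comp_perm {π : Equiv.Perm (Fin N)} (hπ : π ∈ autGroup 𝒞) (S : Finset (Fin N)) (i : Fin N)
    (y : Fin N → ℝ) :
    num W 𝒞 S i (fun i => y (π i)) = num W 𝒞 (S.map π.toEmbedding) (π i) y :=
  Fintype.sum_equiv (codePerm hπ) _ _ fun c => by
    rw [lik_comp_perm W π S c.1 y]; simp [codePerm]

lemma softEst_comp_perm {π : Equiv.Perm (Fin N)} (hπ : π ∈ autGroup 𝒞) (S : Finset (Fin N))
    (i : Fin N) (y : Fin N → ℝ) :
    softEst W 𝒞 S i (fun i => y (π i)) = softEst W 𝒞 (S.map π.toEmbedding) (π i) y := by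
  rw [softEst, num_comp_perm W hπ, den_comp_perm W hπ, softEst]

lemma estEnergy_map_perm {π : Equiv.Perm (Fin N)} (hπ : π ∈ autGroup 𝒞) (S : Finset (Fin N))
    (i : Fin N) : estEnergy W 𝒞 (S.map π.toEmbedding) (π i) = estEnergy W 𝒞 S i := by
  have h := (((bddMeas_softEst W 𝒞 S i).pow 2).mul (bddMeas_den W 𝒞 Finset.univ)).integral_comp
    (measurePreserving_comp_embedding W.ref π.toEmbedding)
  simp only [Equiv.coe_toEmbedding] at h
  simp_rw [softEst_comp_perm W hπ, den_comp_perm W hπ, Finset.map_univ_equiv] at h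
  rw [estEnergy, estEnergy, h]

lemma map_erase_perm (π : Equiv.Perm (Fin N)) (i : Fin N) :
    (Finset.univ.erase i).map π.toEmbedding = Finset.univ.erase (π i) := by
  rw [Finset.map_erase, Finset.map_univ_equiv]; rfl

/-- The information-theoretic bound: a transitive code of rate below capacity has correlated soft
estimates. -/
lemma capacity_sub_rate_le [NeZero N] (ht : IsTransitive 𝒞) :
    W.capacity - rate 𝒞 ≤ estEnergy W 𝒞 (Finset.univ.erase 0) 0 := by
  have hl := Real.log_pos one_lt_two
  have hN : (0 : ℝ) < N := by exact_mod_cast Nat.pos_of_ne_zero (NeZero.ne N)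
  have h1 := (le_outDiv_univ W 𝒞).trans (outDiv_le W 𝒞 Finset.univ)
  have h2 : ∀ i ∈ Finset.univ, estEnergy W 𝒞 (Finset.univ.erase i) i =
      estEnergy W 𝒞 (Finset.univ.erase 0) 0 := by
    intro i _
    obtain ⟨π, hπ, rfl⟩ := ht 0 i
    rw [← map_erase_perm, estEnergy_map_perm W hπ]
  have h3 : Real.log (Nat.card 𝒞) = Module.finrank (ZMod 2) 𝒞 * Real.log 2 := by
    rw [Module.natCard_eq_pow_finrank (K := ZMod 2), Nat.card_zmod]
    push_cast
    rw [Real.log_pow]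
  rw [Finset.sum_congr rfl h2, Finset.sum_const, Finset.card_univ, Fintype.card_fin, nsmul_eq_mul,
    h3] at h1
  have h4 := mul_le_mul_of_nonneg_left W.capacity_mul_log_two_le hN.le
  have h5 : N * rate 𝒞 = Module.finrank (ZMod 2) 𝒞 := mul_div_cancel₀ _ hN.ne'
  rw [← h5] at h1
  have h6 : N * Real.log 2 * (W.capacity - rate 𝒞) ≤
      N * Real.log 2 * estEnergy W 𝒞 (Finset.univ.erase 0) 0 := by linarith
  exact le_of_mul_le_mul_left h6 (mul_pos hN hl)

end

end Code

section Transmission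

variable {N : ℕ} (W : BMSChannel) (𝒞 : Code N)

/-! ### Integrals with respect to the transmission law -/

/-- The output law for the input word `x`. -/
noncomputable abbrev outLaw (x : Fin N → ZMod 2) : Measure (Fin N → ℝ) :=
  Measure.pi fun i => W.law (bpsk (x i))

/-- The BPSK form of a word. -/
noncomputable def word (x : Fin N → ZMod 2) (i : Fin N) : ℝ := chi (x i)

lemma transmitLaw_eq : transmitLaw W 𝒞 =
    (Nat.card 𝒞 : ℝ≥0∞)⁻¹ • ∑ c : 𝒞, (outLaw W c.1).map (Prod.mk (word c.1)) := by
  rw [transmitLaw, Measure.sum_fintype]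
  simp_rw [Measure.dirac_prod]
  rfl

instance : IsProbabilityMeasure (transmitLaw W 𝒞) := by
  refine ⟨?_⟩
  have h : ∀ c : 𝒞, (outLaw W c.1).map (Prod.mk (word c.1)) Set.univ = 1 := fun c => by
    rw [Measure.map_apply measurable_prodMk_left MeasurableSet.univ]
    simp
  rw [transmitLaw_eq, Measure.smul_apply, Measure.finsetSum_apply]
  simp_rw [h]
  rw [Finset.sum_const, Finset.card_univ, nsmul_eq_mul, mul_one, ← Nat.card_eq_fintype_card,
    smul_eq_mul, ENNReal.inv_mul_cancel (by exact_mod_cast (card_code_pos 𝒞).ne')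
      (ENNReal.natCast_ne_top _)]

lemma ae_transmitLaw {p : (Fin N → ℝ) × (Fin N → ℝ) → Prop} (hp : MeasurableSet {ω | p ω})
    (h : ∀ c : 𝒞, ∀ y, p (word c.1, y)) : ∀ᵐ ω ∂transmitLaw W 𝒞, p ω := by
  rw [transmitLaw_eq]
  refine Measure.ae_smul_measure ?_ _
  rw [ae_iff, Measure.finsetSum_apply]
  refine Finset.sum_eq_zero fun c _ => ?_
  have hm : MeasurableSet {ω | ¬p ω} := hp.compl
  rw [Measure.map_apply measurable_prodMk_left hm]
  have : Prod.mk (word c.1) ⁻¹' {ω | ¬p ω} = ∅ := by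
    ext y; simp [h c y]
  exact (congrArg _ this).trans measure_empty

variable {W 𝒞} in
lemma integrable_transmitLaw {G : (Fin N → ℝ) × (Fin N → ℝ) → ℝ} (hG : Measurable G)
    (hb : ∀ c : 𝒞, BddMeas fun y => G (word c.1, y)) : Integrable G (transmitLaw W 𝒞) := by
  rw [transmitLaw_eq]
  refine Integrable.smul_measure ?_ (by simp)
  rw [integrable_finsetSum_measure]
  intro c _
  rw [integrable_map_measure hG.aestronglyMeasurable measurable_prodMk_left.aemeasurable]
  exact (hb c).integrable _

lemma integral_transmitLaw {G : (Fin N → ℝ) × (Fin N → ℝ) → ℝ} (hG : Measurable G)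
    (hb : ∀ c : 𝒞, BddMeas fun y => G (word c.1, y)) :
    ∫ ω, G ω ∂transmitLaw W 𝒞 =
      (Nat.card 𝒞 : ℝ)⁻¹ * ∑ c : 𝒞, ∫ y, G (word c.1, y) ∂outLaw W c.1 := by
  rw [transmitLaw_eq, integral_smul_measure, integral_finsetSum_measure]
  · simp only [ENNReal.toReal_inv, ENNReal.toReal_natCast, smul_eq_mul]
    congr 1
    refine Finset.sum_congr rfl fun c _ => ?_
    rw [integral_map measurable_prodMk_left.aemeasurable hG.aestronglyMeasurable]
  · intro c _
    rw [integrable_map_measure hG.aestronglyMeasurable measurable_prodMk_left.aemeasurable]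
    exact (hb c).integrable _

lemma outLaw_eq_withDensity (x : Fin N → ZMod 2) :
    outLaw W x = (W.refPi N).withDensity fun y => ENNReal.ofReal (lik W Finset.univ x y) := by
  have ht := W.measurable_softBit
  refine Measure.pi_eq fun s hs => ?_
  have hbox := MeasurableSet.univ_pi hs
  -- It suffices to compare boxes; there the indicator times the density is a product of functions
  -- of separate coordinates, whose integral factors.
  rw [withDensity_apply _ hbox, ← lintegral_indicator hbox]
  have e : ∀ y : Fin N → ℝ, (Set.univ.pi s).indicator
      (fun y => ENNReal.ofReal (lik W Finset.univ x y)) y =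
      ∏ i, (s i).indicator (fun a => ENNReal.ofReal (1 + chi (x i) * W.softBit a)) (y i) := by
    intro y
    by_cases hy : y ∈ Set.univ.pi s
    · rw [Set.indicator_of_mem hy, lik, ENNReal.ofReal_prod_of_nonneg fun i _ => factor_nonneg W _ _]
      exact Finset.prod_congr rfl fun i _ => by rw [Set.indicator_of_mem (hy i trivial)]
    · rw [Set.indicator_of_notMem hy]
      simp only [Set.mem_pi, Set.mem_univ, true_implies, not_forall] at hy
      obtain ⟨i, hi⟩ := hy
      exact (Finset.prod_eq_zero (Finset.mem_univ i) (Set.indicator_of_notMem hi _)).symm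
  have hm : ∀ i, Measurable ((s i).indicator
      fun a => ENNReal.ofReal (1 + chi (x i) * W.softBit a)) := fun i =>
    Measurable.indicator (by fun_prop) (hs i)
  simp_rw [e]
  have hind := ProbabilityTheory.iIndepFun_pi (μ := fun _ : Fin N => W.ref)
    (X := fun i => (s i).indicator fun a => ENNReal.ofReal (1 + chi (x i) * W.softBit a))
    fun i => (hm i).aemeasurable
  rw [ProbabilityTheory.lintegral_prod_eq_prod_lintegral_of_indepFun _ _ hind
    fun i => (hm i).comp (measurable_pi_apply i)]
  refine Finset.prod_congr rfl fun i _ => ?_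
  rw [(measurePreserving_eval (fun _ : Fin N => W.ref) i).lintegral_comp (hm i),
    lintegral_indicator (hs i), W.law_eq, withDensity_apply _ (hs i)]
  rfl

lemma integral_outLaw (x : Fin N → ZMod 2) (g : (Fin N → ℝ) → ℝ) :
    ∫ y, g y ∂outLaw W x = ∫ y, g y * lik W Finset.univ x y ∂W.refPi N := by
  rw [outLaw_eq_withDensity, integral_withDensity_eq_integral_toReal_smul
    (bddMeas_lik W _ x).meas.ennreal_ofReal (by simp)]
  refine integral_congr_ae (Filter.Eventually.of_forall fun y => ?_)
  simp only [smul_eq_mul]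
  rw [ENNReal.toReal_ofReal (lik_nonneg W _ _ _), mul_comm]

lemma integral_obs {g : (Fin N → ℝ) → ℝ} (hg : BddMeas g) :
    ∫ ω, g ω.2 ∂transmitLaw W 𝒞 =
      (Nat.card 𝒞 : ℝ)⁻¹ * ∫ y, g y * den W 𝒞 Finset.univ y ∂W.refPi N := by
  rw [integral_transmitLaw W 𝒞 (G := fun ω => g ω.2) (hg.meas.comp measurable_snd) fun _ => hg]
  simp_rw [integral_outLaw, den, Finset.mul_sum]
  rw [integral_finsetSum _ fun c _ => (hg.mul (bddMeas_lik W _ _)).integrable _, Finset.mul_sum]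

lemma measurable_symbol_mul {g : (Fin N → ℝ) → ℝ} (hg : BddMeas g) (i : Fin N) :
    Measurable fun ω : (Fin N → ℝ) × (Fin N → ℝ) => ω.1 i * g ω.2 :=
  ((measurable_pi_apply i).comp measurable_fst).mul (hg.meas.comp measurable_snd)

lemma integral_symbol_mul {g : (Fin N → ℝ) → ℝ} (hg : BddMeas g) (i : Fin N) :
    ∫ ω, ω.1 i * g ω.2 ∂transmitLaw W 𝒞 =
      (Nat.card 𝒞 : ℝ)⁻¹ * ∫ y, g y * num W 𝒞 Finset.univ i y ∂W.refPi N := by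
  rw [integral_transmitLaw W 𝒞 (measurable_symbol_mul hg i) fun c => hg.const_mul _]
  simp_rw [integral_const_mul, integral_outLaw, num, Finset.mul_sum, mul_left_comm (g _) (chi _)]
  rw [integral_finsetSum _ fun c _ => ((hg.mul (bddMeas_lik W _ _)).const_mul _).integrable _,
    Finset.mul_sum]
  simp_rw [integral_const_mul]
  rfl

lemma integral_symbol_mul_eq {g : (Fin N → ℝ) → ℝ} (hg : BddMeas g) {S : Finset (Fin N)}
    (h : ∀ j ∉ S, ∀ y, g (flip j y) = g y) (i : Fin N) :
    ∫ ω, ω.1 i * g ω.2 ∂transmitLaw W 𝒞 =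
      ∫ ω, g ω.2 * softEst W 𝒞 S i ω.2 ∂transmitLaw W 𝒞 := by
  rw [integral_symbol_mul W 𝒞 hg, integral_mul_num_univ W 𝒞 hg h,
    integral_obs W 𝒞 (hg.mul (bddMeas_softEst W 𝒞 S i))]

lemma estEnergy_eq_integral (S : Finset (Fin N)) (i : Fin N) :
    estEnergy W 𝒞 S i = ∫ ω, softEst W 𝒞 S i ω.2 ^ 2 ∂transmitLaw W 𝒞 :=
  (integral_obs W 𝒞 ((bddMeas_softEst W 𝒞 S i).pow 2)).symm

lemma estEnergy_nonneg (S : Finset (Fin N)) (i : Fin N) : 0 ≤ estEnergy W 𝒞 S i := by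
  rw [estEnergy_eq_integral]
  exact integral_nonneg fun ω => sq_nonneg _

variable {W 𝒞} in
lemma integrable_obs {g : (Fin N → ℝ) → ℝ} (hg : BddMeas g) :
    Integrable (fun ω => g ω.2) (transmitLaw W 𝒞) :=
  (hg.comp measurable_snd).integrable _

lemma estEnergy_le_one (S : Finset (Fin N)) (i : Fin N) : estEnergy W 𝒞 S i ≤ 1 := by
  rw [estEnergy_eq_integral]
  refine (integral_mono (integrable_obs ((bddMeas_softEst W 𝒞 S i).pow 2))
    (integrable_const 1) fun ω => ?_).trans (by simp)
  exact (sq_le_one_iff_abs_le_one _).2 (abs_softEst_le W 𝒞 S i ω.2)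

lemma integral_symbol_mul_softEst (S : Finset (Fin N)) (i : Fin N) :
    ∫ ω, ω.1 i * softEst W 𝒞 S i ω.2 ∂transmitLaw W 𝒞 = estEnergy W 𝒞 S i := by
  rw [integral_symbol_mul_eq W 𝒞 (bddMeas_softEst W 𝒞 S i) (S := S)
    fun j hj y => softEst_congr W 𝒞 i (flip_agree hj y), estEnergy_eq_integral]
  simp_rw [sq]

lemma integrable_symbol (i : Fin N) : Integrable (fun ω => ω.1 i) (transmitLaw W 𝒞) :=
  integrable_transmitLaw ((measurable_pi_apply i).comp measurable_fst) fun _ => BddMeas.const _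

/-! ### The extrinsic estimates -/

section

variable [NeZero N]

/-- The conditional mean of the symbol at `0` given the other outputs. -/
noncomputable def extEst : (Fin N → ℝ) → ℝ := softEst W 𝒞 (Finset.univ.erase 0) 0

/-- The second moment of the extrinsic estimate. -/
noncomputable def extEnergy : ℝ := estEnergy W 𝒞 (Finset.univ.erase 0) 0

lemma bddMeas_extEst : BddMeas (extEst W 𝒞) := bddMeas_softEst W 𝒞 _ _

lemma extEst_congr {y z : Fin N → ℝ} (h : ∀ j, j ≠ 0 → y j = z j) :
    extEst W 𝒞 y = extEst W 𝒞 z :=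
  softEst_congr W 𝒞 0 fun j hj => h j (Finset.ne_of_mem_erase hj)

lemma extrinsic_le : extrinsic N ≤ (inferInstance : MeasurableSpace ((Fin N → ℝ) × (Fin N → ℝ))) :=
  Measurable.comap_le (by fun_prop)

lemma stronglyMeasurable_extEst :
    StronglyMeasurable[extrinsic N] fun ω : (Fin N → ℝ) × (Fin N → ℝ) => extEst W 𝒞 ω.2 := by
  let e : ({i : Fin N // i ≠ 0} → ℝ) → Fin N → ℝ := fun z i => if h : i ≠ 0 then z ⟨i, h⟩ else 0
  have he : Measurable e := by
    refine measurable_pi_lambda _ fun i => ?_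
    by_cases h : i ≠ 0
    · simp only [e, dif_pos h]; fun_prop
    · simp only [e, dif_neg h]; fun_prop
  have h : (fun ω : (Fin N → ℝ) × (Fin N → ℝ) => extEst W 𝒞 ω.2) =
      (fun z => extEst W 𝒞 (e z)) ∘
        fun (ω : (Fin N → ℝ) × (Fin N → ℝ)) (i : {i : Fin N // i ≠ 0}) => ω.2 i.1 := by
    funext ω
    exact extEst_congr W 𝒞 fun j hj => by simp [e, hj]
  rw [h]
  exact (((bddMeas_extEst W 𝒞).meas.comp he).comp (comap_measurable _)).stronglyMeasurable

lemma extEst_ae_eq_condMean :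
    (fun ω : (Fin N → ℝ) × (Fin N → ℝ) => extEst W 𝒞 ω.2) =ᵐ[transmitLaw W 𝒞] condMean W 𝒞 := by
  refine ae_eq_condExp_of_forall_setIntegral_eq extrinsic_le (integrable_symbol W 𝒞 0)
    (fun s _ _ => (integrable_obs (bddMeas_extEst W 𝒞)).integrableOn) ?_
    (stronglyMeasurable_extEst W 𝒞).aestronglyMeasurable
  rintro s ⟨B, hB, rfl⟩ -
  set r : (Fin N → ℝ) → {i : Fin N // i ≠ 0} → ℝ := fun y i => y i.1 with hr
  have hrm : Measurable r := by fun_prop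
  have hs : MeasurableSet ((fun (ω : (Fin N → ℝ) × (Fin N → ℝ)) (i : {i : Fin N // i ≠ 0}) =>
      ω.2 i.1) ⁻¹' B) := (hrm.comp measurable_snd) hB
  have bg : BddMeas ((r ⁻¹' B).indicator fun _ => (1 : ℝ)) :=
    ⟨measurable_const.indicator (hrm hB), 1, fun y => by
      by_cases h : y ∈ r ⁻¹' B <;> simp [h]⟩
  -- An extrinsic event ignores output 0, so its indicator is invariant under flipping that output
  -- and the projection property of the soft estimate applies to it.
  have key := integral_symbol_mul_eq W 𝒞 bg (S := Finset.univ.erase 0) (fun j hj y => by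
    have hj0 : j = 0 := by simpa using hj
    have : r (flip j y) = r y := funext fun i => flip_of_ne (by rw [hj0]; exact i.2) y
    by_cases h : r y ∈ B
    · rw [Set.indicator_of_mem (show flip j y ∈ r ⁻¹' B by rwa [Set.mem_preimage, this]),
        Set.indicator_of_mem (show y ∈ r ⁻¹' B from h)]
    · rw [Set.indicator_of_notMem (show flip j y ∉ r ⁻¹' B by rwa [Set.mem_preimage, this]),
        Set.indicator_of_notMem (show y ∉ r ⁻¹' B from h)]) 0
  have hind : ∀ (f : (Fin N → ℝ) × (Fin N → ℝ) → ℝ) (ω : (Fin N → ℝ) × (Fin N → ℝ)),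
      ((fun (ω : (Fin N → ℝ) × (Fin N → ℝ)) (i : {i : Fin N // i ≠ 0}) =>
        ω.2 i.1) ⁻¹' B).indicator f ω = f ω * (r ⁻¹' B).indicator (fun _ => (1 : ℝ)) ω.2 := by
    intro f ω
    by_cases h : r ω.2 ∈ B
    · rw [Set.indicator_of_mem (show ω.2 ∈ r ⁻¹' B from h), mul_one]
      exact if_pos h
    · rw [Set.indicator_of_notMem (show ω.2 ∉ r ⁻¹' B from h), mul_zero]
      exact if_neg h
  rw [← integral_indicator hs, ← integral_indicator hs]
  simp_rw [hind]
  rw [key]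
  simp_rw [mul_comm]
  rfl

lemma extMMSE_eq : extMMSE W 𝒞 = 1 - extEnergy W 𝒞 := by
  have bm := bddMeas_extEst W 𝒞
  have e1 : extMMSE W 𝒞 = ∫ ω, (ω.1 0 - extEst W 𝒞 ω.2) ^ 2 ∂transmitLaw W 𝒞 := by
    refine integral_congr_ae ?_
    filter_upwards [extEst_ae_eq_condMean W 𝒞] with ω hω
    rw [hω]
  have e2 : ∫ ω, (ω.1 0 - extEst W 𝒞 ω.2) ^ 2 ∂transmitLaw W 𝒞 =
      ∫ ω, (1 - 2 * (ω.1 0 * extEst W 𝒞 ω.2) + extEst W 𝒞 ω.2 ^ 2) ∂transmitLaw W 𝒞 := by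
    refine integral_congr_ae (ae_transmitLaw W 𝒞 ?_ fun c y => ?_)
    · have h0 : Measurable fun ω : (Fin N → ℝ) × (Fin N → ℝ) => ω.1 0 := by fun_prop
      have h1 : Measurable fun ω : (Fin N → ℝ) × (Fin N → ℝ) => extEst W 𝒞 ω.2 :=
        bm.meas.comp measurable_snd
      exact measurableSet_eq_fun ((h0.sub h1).pow_const 2)
        ((((h0.mul h1).const_mul 2).const_sub 1).add (h1.pow_const 2))
    · have := chi_mul_self (c.1 0)
      simp only [word]
      linear_combination this
  have i1 : Integrable (fun ω => ω.1 0 * extEst W 𝒞 ω.2) (transmitLaw W 𝒞) :=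
    integrable_transmitLaw (measurable_symbol_mul bm 0) fun c => bm.const_mul _
  have i2 : Integrable (fun ω => 1 - 2 * (ω.1 0 * extEst W 𝒞 ω.2)) (transmitLaw W 𝒞) :=
    (integrable_const 1).sub (i1.const_mul 2)
  rw [e1, e2, integral_add i2 (integrable_obs (bm.pow 2)),
    integral_sub (integrable_const 1) (i1.const_mul 2), integral_const_mul]
  have h1 := integral_symbol_mul_softEst W 𝒞 (Finset.univ.erase 0) 0
  have h2 := estEnergy_eq_integral W 𝒞 (Finset.univ.erase 0) 0
  rw [extEnergy, extEst, h1, ← h2]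
  simp only [integral_const, probReal_univ, smul_eq_mul, mul_one]
  ring

lemma posterior_ae_eq :
    posterior W 𝒞 =ᵐ[transmitLaw W 𝒞] fun ω => (1 - extEst W 𝒞 ω.2) / 2 := by
  have h0 : Measurable fun ω : (Fin N → ℝ) × (Fin N → ℝ) => ω.1 0 := by fun_prop
  have e : Set.indicator {ω : (Fin N → ℝ) × (Fin N → ℝ) | ω.1 0 = -1} (fun _ => (1 : ℝ))
      =ᵐ[transmitLaw W 𝒞] (2⁻¹ : ℝ) • ((fun _ => 1) - fun ω => ω.1 0) := by
    refine ae_transmitLaw W 𝒞 (measurableSet_eq_fun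
      (measurable_const.indicator (measurableSet_eq_fun h0 measurable_const))
      ((measurable_const.sub h0).const_smul _)) fun c y => ?_
    rcases chi_eq_or (c.1 0) with h | h
    · simp [Set.indicator, word, h]; norm_num
    · simp [Set.indicator, word, h]; norm_num
  have h1 := condExp_congr_ae (m := extrinsic N) e
  have h2 := condExp_smul (μ := transmitLaw W 𝒞) (2⁻¹ : ℝ)
    ((fun _ => (1 : ℝ)) - fun ω : (Fin N → ℝ) × (Fin N → ℝ) => ω.1 0) (extrinsic N)
  have h3 := condExp_sub (integrable_const (1 : ℝ)) (integrable_symbol W 𝒞 0) (extrinsic N)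
  have h4 := condExp_const (μ := transmitLaw W 𝒞) (extrinsic_le (N := N)) (1 : ℝ)
  filter_upwards [h1, h2, h3, extEst_ae_eq_condMean W 𝒞] with ω a1 a2 a3 a4
  rw [posterior, a1, a2, Pi.smul_apply, a3, Pi.sub_apply, h4, a4, condMean, smul_eq_mul]
  ring

lemma two_mul_bitErrorProb_le : 2 * bitErrorProb W 𝒞 ≤ extMMSE W 𝒞 := by
  have bm := bddMeas_extEst W 𝒞
  have e : bitErrorProb W 𝒞 = ∫ ω, (1 - |extEst W 𝒞 ω.2|) / 2 ∂transmitLaw W 𝒞 := by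
    refine integral_congr_ae ?_
    filter_upwards [posterior_ae_eq W 𝒞] with ω hω
    rw [hω]
    rcases le_total 0 (extEst W 𝒞 ω.2) with h | h
    · rw [abs_of_nonneg h, min_eq_left (by linarith)]
    · rw [abs_of_nonpos h, min_eq_right (by linarith)]
      ring
  have b1 : BddMeas fun y => 2 * ((1 - |extEst W 𝒞 y|) / 2) :=
    BddMeas.continuous_comp (φ := fun x => 2 * ((1 - |x|) / 2)) (by fun_prop) bm
  have b2 : BddMeas fun y => 1 - extEst W 𝒞 y ^ 2 := (BddMeas.const 1).sub (bm.pow 2)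
  have h2 : extEnergy W 𝒞 = ∫ ω, extEst W 𝒞 ω.2 ^ 2 ∂transmitLaw W 𝒞 :=
    estEnergy_eq_integral W 𝒞 (Finset.univ.erase 0) 0
  have h3 : ∫ ω, (1 - extEst W 𝒞 ω.2 ^ 2) ∂transmitLaw W 𝒞 = 1 - extEnergy W 𝒞 := by
    have i2 : Integrable (fun ω => extEst W 𝒞 ω.2 ^ 2) (transmitLaw W 𝒞) :=
      integrable_obs (g := fun y => extEst W 𝒞 y ^ 2) (bm.pow 2)
    rw [integral_sub (integrable_const 1) i2, h2]
    simp
  rw [extMMSE_eq, ← h3, e, ← integral_const_mul]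
  have i1 : Integrable (fun ω => 2 * ((1 - |extEst W 𝒞 ω.2|) / 2)) (transmitLaw W 𝒞) :=
    integrable_obs (g := fun y => 2 * ((1 - |extEst W 𝒞 y|) / 2)) b1
  have i2 : Integrable (fun ω => 1 - extEst W 𝒞 ω.2 ^ 2) (transmitLaw W 𝒞) :=
    integrable_obs (g := fun y => 1 - extEst W 𝒞 y ^ 2) b2
  -- Pointwise, 1 - |m| ≤ 1 - m² since |m| ≤ 1.
  refine integral_mono i1 i2 fun ω => ?_
  have h := abs_softEst_le W 𝒞 (Finset.univ.erase 0) 0 ω.2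
  have h' : |extEst W 𝒞 ω.2| ≤ 1 := h
  have := sq_abs (extEst W 𝒞 ω.2)
  have := abs_nonneg (extEst W 𝒞 ω.2)
  dsimp only
  nlinarith

end

/-! ### Reduction to the all-ones input -/

lemma softBit_chi_mul (u : ZMod 2) (a : ℝ) : W.softBit (chi u * a) = chi u * W.softBit a := by
  rcases chi_eq_or u with h | h <;> simp [h, W.softBit_neg]

lemma lik_twist (S : Finset (Fin N)) (x c : Fin N → ZMod 2) (y : Fin N → ℝ) :
    lik W S x (fun i => chi (c i) * y i) = lik W S (x + c) y := by
  refine Finset.prod_congr rfl fun j _ => ?_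
  rw [softBit_chi_mul, Pi.add_apply, chi_add, mul_assoc]

variable {𝒞} in
-- Multiplying the outputs by the signs of a codeword `c` translates the code by `c`, which permutes
-- the sum over codewords and leaves only the sign at `i`.
lemma softEst_twist {c : Fin N → ZMod 2} (hc : c ∈ 𝒞) (S : Finset (Fin N)) (i : Fin N)
    (y : Fin N → ℝ) :
    softEst W 𝒞 S i (fun j => chi (c j) * y j) = chi (c i) * softEst W 𝒞 S i y := by
  have hd : den W 𝒞 S (fun j => chi (c j) * y j) = den W 𝒞 S y :=
    Fintype.sum_equiv (Equiv.addRight (⟨c, hc⟩ : 𝒞)) _ _ fun x => lik_twist W S x.1 c y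
  have hn : num W 𝒞 S i (fun j => chi (c j) * y j) = chi (c i) * num W 𝒞 S i y := by
    rw [num, num, Finset.mul_sum]
    refine Fintype.sum_equiv (Equiv.addRight (⟨c, hc⟩ : 𝒞)) _ _ fun x => ?_
    rw [lik_twist]
    simp only [Equiv.coe_addRight, Submodule.coe_add, Pi.add_apply, chi_add]
    linear_combination -(chi (x.1 i) * lik W S (x.1 + c) y) * chi_mul_self (c i)
  rw [softEst, softEst, hd, hn, mul_div_assoc]

lemma measurePreserving_twist (c : Fin N → ZMod 2) :
    MeasurePreserving (fun (y : Fin N → ℝ) i => chi (c i) * y i)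
      (Measure.pi fun _ => W.law 1) (outLaw W c) := by
  refine measurePreserving_pi (fun _ => W.law 1) (fun i => W.law (bpsk (c i)))
    (f := fun i a => chi (c i) * a) fun i => ?_
  rw [chi]
  rcases Int.units_eq_one_or (bpsk (c i)) with h | h
  · rw [h]
    simp only [sgn_one, one_mul]
    exact MeasurePreserving.id _
  · rw [h]
    simp only [sgn_neg, sgn_one, neg_mul, one_mul]
    exact ⟨measurable_neg, W.law_neg_one.symm⟩

/-- The outputs for codeword `c` are distributed as sign-twisted outputs of the all-ones input. The
sign produced by `g` cancels the transmitted symbol, so all codewords contribute equally. -/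
lemma integral_symbol_mul_twist {g : (Fin N → ℝ) → ℝ} (hg : BddMeas g) (i : Fin N)
    (h : ∀ c ∈ 𝒞, ∀ y, g (fun j => chi (c j) * y j) = chi (c i) * g y) :
    ∫ ω, ω.1 i * g ω.2 ∂transmitLaw W 𝒞 = ∫ y, g y ∂(Measure.pi fun _ => W.law 1) := by
  rw [integral_transmitLaw W 𝒞 (measurable_symbol_mul hg i) fun c => hg.const_mul _]
  have : ∀ c : 𝒞, ∫ y, word c.1 i * g y ∂outLaw W c.1 =
      ∫ y, g y ∂(Measure.pi fun _ => W.law 1) := by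
    intro c
    rw [← (hg.const_mul _).integral_comp (measurePreserving_twist W c.1)]
    simp_rw [h c.1 c.2, word, ← mul_assoc, chi_mul_self, one_mul]
  simp only [this]
  rw [Finset.sum_const, Finset.card_univ, nsmul_eq_mul, ← Nat.card_eq_fintype_card, ← mul_assoc,
    inv_mul_cancel₀ (card_code_pos 𝒞).ne', one_mul]

lemma integral_sq_twist {g : (Fin N → ℝ) → ℝ} (hg : BddMeas g) (i : Fin N)
    (h : ∀ c ∈ 𝒞, ∀ y, g (fun j => chi (c j) * y j) = chi (c i) * g y) :
    ∫ ω, g ω.2 ^ 2 ∂transmitLaw W 𝒞 = ∫ y, g y ^ 2 ∂(Measure.pi fun _ => W.law 1) := by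
  rw [integral_transmitLaw W 𝒞 (G := fun ω => g ω.2 ^ 2) ((hg.pow 2).meas.comp measurable_snd)
    fun _ => hg.pow 2]
  have : ∀ c : 𝒞, ∫ y, g y ^ 2 ∂outLaw W c.1 =
      ∫ y, g y ^ 2 ∂(Measure.pi fun _ => W.law 1) := by
    intro c
    rw [← (hg.pow 2).integral_comp (measurePreserving_twist W c.1)]
    simp_rw [h c.1 c.2, mul_pow, sq (chi _), chi_mul_self, one_mul]
  simp only [this]
  rw [Finset.sum_const, Finset.card_univ, nsmul_eq_mul, ← Nat.card_eq_fintype_card, ← mul_assoc,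
    inv_mul_cancel₀ (card_code_pos 𝒞).ne', one_mul]

end Transmission

/-! ### The two-look recursion -/

section Recursion

variable {N N' : ℕ} {𝒞 : Code N'} {𝒞' : Code N}

lemma mem_of_project_eq {u : Fin N ↪ Fin N'} (h : project 𝒞 u = 𝒞') {c : Fin N' → ZMod 2}
    (hc : c ∈ 𝒞) : (fun i => c (u i)) ∈ 𝒞' :=
  h ▸ Submodule.mem_map_of_mem (f := LinearMap.funLeft (ZMod 2) (ZMod 2) u) hc

variable [NeZero N] (W : BMSChannel)

lemma extEst_twist {c : Fin N → ZMod 2} (hc : c ∈ 𝒞') (y : Fin N → ℝ) :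
    extEst W 𝒞' (fun j => chi (c j) * y j) = chi (c 0) * extEst W 𝒞' y :=
  softEst_twist W hc _ 0 y

/-- With the all-ones input, mean and second moment of the extrinsic estimate coincide, both being
E[X₀ m] = E[m²]. This makes the empty-set energy the square of the full one. -/
lemma integral_extEst (𝒞' : Code N) :
    ∫ y, extEst W 𝒞' y ∂(Measure.pi fun _ => W.law 1) = extEnergy W 𝒞' := by
  rw [← integral_symbol_mul_twist W 𝒞' (bddMeas_extEst W 𝒞') 0 fun c hc y => extEst_twist W hc y]
  exact integral_symbol_mul_softEst W 𝒞' _ 0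

lemma integral_extEst_sq (𝒞' : Code N) :
    ∫ y, extEst W 𝒞' y ^ 2 ∂(Measure.pi fun _ => W.law 1) = extEnergy W 𝒞' := by
  rw [← integral_sq_twist W 𝒞' (bddMeas_extEst W 𝒞') 0 fun c hc y => extEst_twist W hc y]
  exact (estEnergy_eq_integral W 𝒞' _ 0).symm

lemma condEnergy_extEst_map {σ : Equiv.Perm (Fin N)} (hσ : σ ∈ bitStabilizer 𝒞')
    (S : Finset (Fin N)) :
    condEnergy (W.law 1) (extEst W 𝒞') (S.map σ.toEmbedding) =
      condEnergy (W.law 1) (extEst W 𝒞') S := by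
  have h0 : σ 0 = 0 := hσ.2
  have hF : (fun y : Fin N → ℝ => extEst W 𝒞' fun k => y (σ.toEmbedding k)) = extEst W 𝒞' := by
    funext y
    have := softEst_comp_perm W hσ.1 (Finset.univ.erase 0) 0 y
    rwa [map_erase_perm, h0] at this
  have h := condEnergy_comp_embedding (ν := W.law 1) σ.toEmbedding (bddMeas_extEst W 𝒞')
    (S.map σ.toEmbedding)
  rw [hF] at h
  rw [h]
  congr 1
  ext i
  simp

lemma captureProb_le_maxCaptureProb (𝒞' : Code N) {S A : Finset (Fin N)} (hS : S.Nonempty)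
    (h0 : 0 ∉ S) : captureProb 𝒞' S A ≤ maxCaptureProb 𝒞' A :=
  le_ciSup (f := fun S : {S : Finset (Fin N) // S.Nonempty ∧ 0 ∉ S} => captureProb 𝒞' S.1 A)
    (Set.finite_range _).bddAbove ⟨S, hS, h0⟩

lemma maxCaptureProb_nonneg (𝒞' : Code N) (A : Finset (Fin N)) : 0 ≤ maxCaptureProb 𝒞' A :=
  Real.iSup_nonneg fun _ => div_nonneg (Nat.cast_nonneg _) (Nat.cast_nonneg _)

lemma condEnergy_extEst_le (𝒞' : Code N) {A : Finset (Fin N)} (hA : 0 ∉ A) {ρ : ℝ}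
    (hρ : maxCaptureProb 𝒞' A ≤ ρ) :
    condEnergy (W.law 1) (extEst W 𝒞') A ≤
      (1 - ρ) * extEnergy W 𝒞' ^ 2 + ρ * extEnergy W 𝒞' := by
  have h := (interPSD_condEnergy (ν := W.law 1) (bddMeas_extEst W 𝒞')).le_of_capture
    (bitStabilizer 𝒞') (fun σ hσ S => condEnergy_extEst_map W hσ S) A (ρ := ρ) ?_
  · rwa [condEnergy_empty, condEnergy_univ, integral_extEst, integral_extEst_sq] at h
  · intro S hS
    -- A set containing 0 is never captured: the stabilizer fixes 0, which is not in `A`.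
    by_cases h0 : 0 ∈ S
    · have : IsEmpty {σ : bitStabilizer 𝒞' // ∀ i ∈ S, σ.1 i ∈ A} := ⟨fun σ => hA (by
        have h1 := σ.2 0 h0
        have h2 : σ.1.1 0 = 0 := σ.1.2.2
        rwa [h2] at h1)⟩
      rw [Nat.card_of_isEmpty, Nat.cast_zero, zero_div]
      exact (maxCaptureProb_nonneg 𝒞' A).trans hρ
    · exact (captureProb_le_maxCaptureProb 𝒞' hS h0).trans hρ

/-- The extrinsic estimate of `𝒞'` from one look. -/
noncomputable def lookEst (𝒞' : Code N) (u : Fin N ↪ Fin N') (y : Fin N' → ℝ) : ℝ :=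
  extEst W 𝒞' fun i => y (u i)

lemma bddMeas_lookEst (u : Fin N ↪ Fin N') : BddMeas (lookEst W 𝒞' u) :=
  (bddMeas_extEst W 𝒞').comp (by fun_prop)

lemma integral_lookEst (u : Fin N ↪ Fin N') :
    ∫ y, lookEst W 𝒞' u y ∂(Measure.pi fun _ => W.law 1) = extEnergy W 𝒞' :=
  ((bddMeas_extEst W 𝒞').integral_comp (measurePreserving_comp_embedding (W.law 1) u)).trans
    (integral_extEst W 𝒞')

lemma integral_lookEst_sq (u : Fin N ↪ Fin N') :
    ∫ y, lookEst W 𝒞' u y ^ 2 ∂(Measure.pi fun _ => W.law 1) = extEnergy W 𝒞' :=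
  (((bddMeas_extEst W 𝒞').pow 2).integral_comp
    (measurePreserving_comp_embedding (W.law 1) u)).trans (integral_extEst_sq W 𝒞')

variable [NeZero N']

lemma lookEst_twist {u : Fin N ↪ Fin N'} (h : project 𝒞 u = 𝒞') (hu : u 0 = 0)
    {c : Fin N' → ZMod 2} (hc : c ∈ 𝒞) (y : Fin N' → ℝ) :
    lookEst W 𝒞' u (fun j => chi (c j) * y j) = chi (c 0) * lookEst W 𝒞' u y := by
  have := extEst_twist W (mem_of_project_eq h hc) fun i => y (u i)
  rwa [hu] at this

lemma lookEst_congr {u : Fin N ↪ Fin N'} (hu : u 0 = 0) {S : Finset (Fin N')}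
    (hS : Finset.univ.map u = insert 0 S) {y z : Fin N' → ℝ} (h : ∀ i ∈ S, y i = z i) :
    lookEst W 𝒞' u y = lookEst W 𝒞' u z := by
  refine extEst_congr W 𝒞' fun j hj => h _ ?_
  have h1 : u j ∈ insert 0 S := hS ▸ Finset.mem_map_of_mem u (Finset.mem_univ j)
  refine (Finset.mem_insert.1 h1).resolve_left fun h2 => hj (u.injective ?_)
  rw [h2, hu]

lemma TwoLooks.overlap_nonneg (T : TwoLooks 𝒞 𝒞') : 0 ≤ T.overlap :=
  (maxCaptureProb_nonneg _ _).trans (le_max_left _ _)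

lemma TwoLooks.zero_notMem_A (T : TwoLooks 𝒞 𝒞') : 0 ∉ T.A := by
  intro h
  have : (0 : Fin N') ∈ T.A ∪ T.B ∪ T.C ∪ T.D := by simp [h]
  rw [T.union_eq] at this
  exact Finset.notMem_erase _ _ this

/-- Combining the two looks improves the estimate. -/
lemma TwoLooks.two_mul_extEnergy_le (T : TwoLooks 𝒞 𝒞') {ρ : ℝ} (hρ : T.overlap ≤ ρ)
    (hρ1 : ρ < 1) :
    2 * extEnergy W 𝒞' ≤ extEnergy W 𝒞 * (1 + ρ + (1 - ρ) * extEnergy W 𝒞') := by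
  set q := extEnergy W 𝒞' with hq
  have hq0 : 0 ≤ q := estEnergy_nonneg W 𝒞' _ _
  have hρ0 := T.overlap_nonneg.trans hρ
  set f := lookEst W 𝒞' T.u with hf
  set g := lookEst W 𝒞' T.v with hg
  have bf : BddMeas f := bddMeas_lookEst W T.u
  have bg : BddMeas g := bddMeas_lookEst W T.v
  have bh : BddMeas fun y => f y + g y := bf.add bg
  have hu0 := T.u_zero
  have hv0 := T.v_zero
  have htw : ∀ c ∈ 𝒞, ∀ y, f (fun j => chi (c j) * y j) + g (fun j => chi (c j) * y j) =
      chi (c 0) * (f y + g y) := by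
    intro c hc y
    rw [hf, hg, lookEst_twist W T.project_u hu0 hc, lookEst_twist W T.project_v hv0 hc, mul_add]
  have hdep : ∀ j ∉ Finset.univ.erase (0 : Fin N'), ∀ y, f (flip j y) + g (flip j y) =
      f y + g y := by
    intro j hj y
    have hj0 : j = 0 := by simpa using hj
    have hfl : ∀ i, i ≠ 0 → flip j y i = y i := fun i hi => flip_of_ne (by rwa [hj0]) y
    have key : ∀ w : Fin N ↪ Fin N', w 0 = 0 → lookEst W 𝒞' w (flip j y) = lookEst W 𝒞' w y :=
      fun w hw => extEst_congr W 𝒞' fun i hi => hfl _ fun h => hi (w.injective (h.trans hw.symm))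
    rw [hf, hg, key _ hu0, key _ hv0]
  have hcross : 2 * ∫ y, f y * g y ∂(Measure.pi fun _ => W.law 1) ≤
      2 * ((1 - ρ) * q ^ 2 + ρ * q) := by
    have h := two_mul_integral_mul_le (ν := W.law 1) bf bg (T := T.A ∪ T.B) (T' := T.A ∪ T.C)
      (fun y z h => lookEst_congr W hu0 T.range_u h) (fun y z h => lookEst_congr W hv0 T.range_v h)
    rw [← Finset.union_inter_distrib_left, Finset.disjoint_iff_inter_eq_empty.1 T.disjoint_BC,
      Finset.union_empty] at h
    have e1 : condEnergy (W.law 1) f T.A ≤ (1 - ρ) * q ^ 2 + ρ * q := by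
      rw [show condEnergy (W.law 1) f T.A = _ from
        condEnergy_comp_embedding T.u (bddMeas_extEst W 𝒞') T.A]
      exact condEnergy_extEst_le W 𝒞' (by simpa [hu0] using T.zero_notMem_A)
        ((le_max_left _ _).trans hρ)
    have e2 : condEnergy (W.law 1) g T.A ≤ (1 - ρ) * q ^ 2 + ρ * q := by
      rw [show condEnergy (W.law 1) g T.A = _ from
        condEnergy_comp_embedding T.v (bddMeas_extEst W 𝒞') T.A]
      exact condEnergy_extEst_le W 𝒞' (by simpa [hv0] using T.zero_notMem_A)
        ((le_max_right _ _).trans hρ)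
    linarith
  have hsq : ∫ ω, (f ω.2 + g ω.2) ^ 2 ∂transmitLaw W 𝒞 ≤
      2 * q * (1 + ρ + (1 - ρ) * q) := by
    rw [integral_sq_twist W 𝒞 bh 0 htw]
    have e : ∀ y, (f y + g y) ^ 2 = f y ^ 2 + (g y ^ 2 + 2 * (f y * g y)) := fun y => by ring
    simp_rw [e]
    rw [integral_add ((bf.pow 2).integrable _)
        (((bg.pow 2).add ((bf.mul bg).const_mul 2)).integrable _),
      integral_add ((bg.pow 2).integrable _) (((bf.mul bg).const_mul 2).integrable _),
      integral_const_mul, hf, hg, integral_lookEst_sq, integral_lookEst_sq, ← hf, ← hg]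
    linarith
  have hcorr : ∫ ω, (f ω.2 + g ω.2) * extEst W 𝒞 ω.2 ∂transmitLaw W 𝒞 = 2 * q := by
    have h := integral_symbol_mul_eq W 𝒞 bh hdep 0
    rw [integral_symbol_mul_twist W 𝒞 bh 0 htw, integral_add (bf.integrable _) (bg.integrable _),
      hf, hg, integral_lookEst, integral_lookEst, ← hf, ← hg] at h
    rw [two_mul, hq, h]
    rfl
  set D := 1 + ρ + (1 - ρ) * q with hD
  have hD0 : 0 < D := by
    have := mul_nonneg (sub_nonneg.2 hρ1.le) hq0
    linarith
  have bm := bddMeas_extEst W 𝒞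
  -- The coefficient `1 / D` is the best multiple of `f + g` as an estimate of X₀ when its
  -- correlation is `2 * q` and its second moment is the upper bound `2 * q * D`.
  have hpos : 0 ≤ ∫ ω, (D * extEst W 𝒞 ω.2 - (f ω.2 + g ω.2)) ^ 2 ∂transmitLaw W 𝒞 :=
    integral_nonneg fun ω => sq_nonneg _
  have e : ∀ ω : (Fin N' → ℝ) × (Fin N' → ℝ), (D * extEst W 𝒞 ω.2 - (f ω.2 + g ω.2)) ^ 2 =
      D ^ 2 * extEst W 𝒞 ω.2 ^ 2 +
        ((f ω.2 + g ω.2) ^ 2 - 2 * D * ((f ω.2 + g ω.2) * extEst W 𝒞 ω.2)) := fun ω => by ring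
  have hen : ∫ ω, extEst W 𝒞 ω.2 ^ 2 ∂transmitLaw W 𝒞 = extEnergy W 𝒞 :=
    (estEnergy_eq_integral W 𝒞 _ 0).symm
  simp_rw [e] at hpos
  rw [integral_add (integrable_obs ((bm.pow 2).const_mul _))
      (integrable_obs ((bh.pow 2).sub ((bh.mul bm).const_mul _))),
    integral_sub (integrable_obs (bh.pow 2)) (integrable_obs ((bh.mul bm).const_mul _)),
    integral_const_mul, integral_const_mul, hcorr, hen] at hpos
  have : D * (2 * q) ≤ D * (extEnergy W 𝒞 * D) := by nlinarith
  exact le_of_mul_le_mul_left this hD0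

/-- The odds of the extrinsic mean-squared error contract. -/
lemma TwoLooks.odds_le (T : TwoLooks 𝒞 𝒞') {ρ : ℝ} (hρ : T.overlap ≤ ρ) (hρ1 : ρ < 1)
    {a b : ℝ} (ha : 0 ≤ a) (hb : 0 ≤ b)
    (h : (1 - extEnergy W 𝒞') * a ≤ b * extEnergy W 𝒞') :
    (1 - extEnergy W 𝒞) * a ≤ (1 + ρ) / 2 * b * extEnergy W 𝒞 := by
  have key := T.two_mul_extEnergy_le W hρ hρ1
  have hq0 : 0 ≤ extEnergy W 𝒞' := estEnergy_nonneg W 𝒞' _ _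
  have hρ0 := T.overlap_nonneg.trans hρ
  generalize extEnergy W 𝒞' = q at *
  generalize extEnergy W 𝒞 = q' at *
  have hD0 : 0 < 1 + ρ + (1 - ρ) * q := by
    have := mul_nonneg (sub_nonneg.2 hρ1.le) hq0
    linarith
  refine le_of_mul_le_mul_left ?_ hD0
  -- The contraction rests on D - 2q = (1+ρ)(1-q) with D = 1 + ρ + (1-ρ)q. The odds bound is kept
  -- cross-multiplied, so zero energy needs no separate treatment.
  calc (1 + ρ + (1 - ρ) * q) * ((1 - q') * a)
      = ((1 + ρ + (1 - ρ) * q) - q' * (1 + ρ + (1 - ρ) * q)) * a := by ring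
    _ ≤ ((1 + ρ + (1 - ρ) * q) - 2 * q) * a := by gcongr
    _ = (1 + ρ) * ((1 - q) * a) := by ring
    _ ≤ (1 + ρ) * (b * q) := by gcongr
    _ = (1 + ρ) / 2 * b * (2 * q) := by ring
    _ ≤ (1 + ρ) / 2 * b * (q' * (1 + ρ + (1 - ρ) * q)) := by gcongr
    _ = _ := by ring

end Recursion

end NestedBMS

theorem lemma7 (W : NestedBMS.BMSChannel) (N : ℕ → ℕ) [∀ k, NeZero (N k)]
    (𝒞 : ∀ k, NestedBMS.Code (N k)) (htrans : ∀ k, NestedBMS.IsTransitive (𝒞 k))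
    (T : ∀ k, NestedBMS.TwoLooks (𝒞 (k + 1)) (𝒞 k))
    (ρ₀ : ℝ) (hρ₀ : ρ₀ < 1) (hρ : ∀ k, (T k).overlap ≤ ρ₀)
    (hrate : NestedBMS.rate (𝒞 0) < W.capacity)
    (δ : ℝ) (hδ : δ = W.capacity - NestedBMS.rate (𝒞 0)) :
    0 < δ ∧ NestedBMS.extMMSE W (𝒞 0) ≤ 1 - δ ∧
      ∀ k, 2 * NestedBMS.bitErrorProb W (𝒞 k) ≤ NestedBMS.extMMSE W (𝒞 k) ∧
        NestedBMS.extMMSE W (𝒞 k) ≤ ((1 + ρ₀) / 2) ^ k * ((1 - δ) / δ) := by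
  have hδ0 : 0 < δ := by linarith
  have h0 : δ ≤ NestedBMS.extEnergy W (𝒞 0) :=
    hδ ▸ NestedBMS.capacity_sub_rate_le W (htrans 0)
  have h1 : ∀ k, NestedBMS.extEnergy W (𝒞 k) ≤ 1 := fun k => NestedBMS.estEnergy_le_one W _ _ _
  have hδ1 : 0 ≤ 1 - δ := by linarith [h1 0]
  have hρ0 : 0 ≤ ρ₀ := (T 0).overlap_nonneg.trans (hρ 0)
  refine ⟨hδ0, by rw [NestedBMS.extMMSE_eq]; linarith, fun k =>
    ⟨NestedBMS.two_mul_bitErrorProb_le W _, ?_⟩⟩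
  -- For `k = 0` this is equivalent to `δ ≤ extEnergy W (𝒞 0)`.
  have hodds : (1 - NestedBMS.extEnergy W (𝒞 k)) * δ ≤
      (((1 + ρ₀) / 2) ^ k * (1 - δ)) * NestedBMS.extEnergy W (𝒞 k) := by
    induction k with
    | zero => nlinarith
    | succ k ih =>
      have := (T k).odds_le W (hρ k) hρ₀ hδ0.le (by positivity) ih
      rwa [← mul_assoc, ← pow_succ'] at this
  rw [NestedBMS.extMMSE_eq, ← mul_div_assoc, le_div_iff₀ hδ0]
  exact hodds.trans (mul_le_of_le_one_right (by positivity) (h1 k))
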